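/- Let $m_1,m_2\ge 3$ and let $$G=\langle t_1,t_2,x,y \mid t_1^{2^{m_1}}=t_2^{2^{m_2}}=1,\ x^2=t_1,\ y^2=t_2,\ t_1,t_2\text{ central},\ (x,y)=t_1^{2^{m_1-1}}\rangle$$ (a group of type $\mathcal D_4$). For a field $K$ with $\operatorname{char}K\nmid |G|$, let $e$ be the exponent of $G$ and $\zeta$ a primitive $e$-th root of unity; two conjugacy classes of $G$ are called $K$-conjugate if one consists of the $r$-th powers of the elements of the other, for some $r$ such that $\sigma(\zeta)=\zeta^r$ for some $\sigma\in\operatorname{Gal}(K(\zeta)/K)$. The equivalence classes are the $K$-classes of $G$. A $K$-class is said to involve $g\in G$ if it is the $K$-class of the conjugacy class of $ag$ for some $a$ in the centre $Z(G)$. Let $N=N_1+N_2+N_3+N_4$, where $N_1$ is the number of cyclic subgroups of $Z(G)$ and $N_2,N_3,N_4$ are the numbers of $\mathbb Q$-classes of $G$ involving $x$, $y$ and $xy$, respectively. Let $N_0$ be the number of cyclic subgroups of $G/G'$. By a quaternion algebra we mean one over some field $L$ containing the ground field: the four-dimensional $L$-algebra generated by $i,j$ with $i^2=a$, $j^2=b$,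 $ij=-ji$ for some nonzero $a,b\in L$ (rings of $2\times 2$ matrices are allowed). Then: 1. $\mathbb QG$ is the direct sum of $N_0$ fields and $N-N_0$ quaternion algebras. 2. For every finite field $K$ of odd order $q$, the group algebra $KG$ is semisimple and its Wedderburn decomposition has at least $2N-10$ simple components. 3. If moreover $q\equiv 3\pmod 8$, then $KG$ has exactly $2N-10$ simple components and is the direct sum of $2N_0-10$ fields and $2(N-N_0)$ quaternion algebras. (In particular $5\le N_0\le N$.) -/

import Mathlib

universe u v w

open scoped Quaternion

/-- The four generators of a group of type `D₄`. -/
inductive D4Gen : Type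
  | x
  | y
  | t₁
  | t₂

namespace D4Gen

/-- The group commutator `(g, h) = g⁻¹ h⁻¹ g h` in the free group. -/
def comm (g h : FreeGroup D4Gen) : FreeGroup D4Gen := g⁻¹ * h⁻¹ * g * h

/-- The relators of the presentation
`⟨t₁, t₂, x, y | t₁^(2^m₁) = t₂^(2^m₂) = 1, x² = t₁, y² = t₂, t₁ and t₂ central,
(x, y) = t₁^(2^(m₁-1))⟩`. -/
def relators (m₁ m₂ : ℕ) : Set (FreeGroup D4Gen) :=
  { FreeGroup.of t₁ ^ 2 ^ m₁,
    FreeGroup.of t₂ ^ 2 ^ m₂,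
    FreeGroup.of x ^ 2 * (FreeGroup.of t₁)⁻¹,
    FreeGroup.of y ^ 2 * (FreeGroup.of t₂)⁻¹,
    comm (FreeGroup.of x) (FreeGroup.of y) * (FreeGroup.of t₁ ^ 2 ^ (m₁ - 1))⁻¹ } ∪
  Set.range (fun g : D4Gen => comm (FreeGroup.of t₁) (FreeGroup.of g)) ∪
  Set.range (fun g : D4Gen => comm (FreeGroup.of t₂) (FreeGroup.of g))

end D4Gen

/-- The group of type `D₄` with parameters `m₁, m₂`. -/
abbrev D4Group (m₁ m₂ : ℕ) : Type := PresentedGroup (D4Gen.relators m₁ m₂)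

/-- The number of cyclic subgroups of a group. -/
noncomputable def numCyclicSubgroups (G : Type u) [Group G] : ℕ :=
  Nat.card {H : Subgroup G // IsCyclic H}

/-- The `K`-class of (the conjugacy class of) `g`, as the union of the conjugacy classes that it
consists of.  With `e` the exponent of `G` and `ζ` a primitive `e`-th root of unity, these are the
conjugacy classes of the powers `g ^ r` such that `ζ ↦ ζ ^ r` for some element of
`Gal(K(ζ)/K)`. -/
def kClass (K : Type v) [Field K] {G : Type u} [Group G] (g : G) : Set G :=
  {h | ∃ (σ : CyclotomicField (Monoid.exponent G) K ≃ₐ[K] CyclotomicField (Monoid.exponent G) K)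
    (ζ : CyclotomicField (Monoid.exponent G) K) (r : ℕ),
    IsPrimitiveRoot ζ (Monoid.exponent G) ∧ σ ζ = ζ ^ r ∧ IsConj (g ^ r) h}

/-- The number of `K`-classes involving `g`: those of the elements `a * g`, for `a` in the centre
of `G`. -/
noncomputable def numKClassesInvolving (K : Type v) [Field K] {G : Type u} [Group G] (g : G) : ℕ :=
  Set.ncard {S : Set G | ∃ a ∈ Subgroup.center G, S = kClass K (a * g)}

/-- The number of simple components of a semisimple ring, that is, of its minimal nonzero
two-sided ideals. -/
noncomputable def numSimpleComponents (A : Type w) [Ring A] : ℕ :=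
  Nat.card {I : TwoSidedIdeal A // IsAtom I}

/-- The `K`-algebra `A` is the direct sum of `f` fields and `q` quaternion algebras.
The centres of the quaternion algebras are fields `L j` containing `K`, and a quaternion algebra
over `L` (of characteristic different from `2`) is generated by `i, j` with
`i² = a`, `j² = b`, `i j = - j i` for nonzero `a, b` in `L`; it may be a ring of
`2 × 2` matrices over `L`. -/
def IsSumOfFieldsAndQuaternions (K : Type v) [Field K] (A : Type w) [Ring A] [Algebra K A]
    (f q : ℕ) : Prop :=
  ∃ (F : Fin f → Type w) (_ : ∀ i, Field (F i)) (_ : ∀ i, Algebra K (F i))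
    (L : Fin q → Type w) (_ : ∀ j, Field (L j)) (_ : ∀ j, Algebra K (L j))
    (a b : ∀ j, L j), (∀ j, a j ≠ 0 ∧ b j ≠ 0) ∧
    Nonempty (A ≃ₐ[K] ((∀ i, F i) × (∀ j, ℍ[L j, a j, b j])))

/-! Write s = x^(2^m₁) for the commutator of x and y. It is central of order 2, and G' = {1, s}.
Since 2 is invertible in K, the idempotents (1 ± s)/2 split KG. The plus half is K[G/G'], a product
of fields. The minus half is spanned over K[Z(G)] by 1, x, y, xy, where x and y anticommute and have
central squares. Over each residue field of K[Z(G)] in which s = -1 it is therefore a quaternion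
algebra (`IsD4.exists_algEquiv`). The theorem thus reduces to counting maximal ideals in group
algebras of abelian 2-groups.

Such maximal ideals are Galois orbits of characters. Over ℚ every odd exponent comes from an
automorphism, so orbits correspond to cyclic subgroups of the dual group
(`charIdeal_eq_iff_zpowers_eq`). Over a field with q elements they are orbits under χ ↦ χ^q
(`charIdeal_eq_iff_powOrbit_eq`). For q odd, the powers of q take at most two of the four odd
residues modulo 8, so a cyclic group of order at least 8 has its generators spread over at least two
orbits. There are exactly two if q ≡ 3 mod 8 (`two_mul_ncard_image_zpowers`). For orders dividing 4
and q ≡ 3 mod 4 there is only one. The dual of G/G' has ten cyclic subgroups of exponent dividing 4,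
whence 2N₀ - 10. Characters with χ(s) = -1 have order at least 8, because s is a fourth power in the
centre, so the quaternion count doubles without correction.

To identify N - N₀ over ℚ, note that a noncentral g is conjugate exactly to g and gs, so its ℚ-class
is determined by the cyclic subgroup that g generates in G/G'. Hence N₀ = c + N₂ + N₃ + N₄, where c
counts cyclic subgroups of the image of Z(G) in G/G' (`IsD4.numCyclicSubgroups_abelianization`). So
N - N₀ = N₁ - c, which is the number of cyclic groups generated by characters of Z(G) with χ(s) =
-1. -/

namespace Set

/-! ### Comparing the sizes of images of maps -/

variable {α β γ : Type*}

/-- On S the map f factors through g. -/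
theorem ncard_image_le_of_imp {S : Set α} {f : α → β} {g : α → γ} (hg : (g '' S).Finite)
    (h : ∀ a ∈ S, ∀ b ∈ S, g a = g b → f a = f b) : (f '' S).ncard ≤ (g '' S).ncard := by
  classical
  rcases S.eq_empty_or_nonempty with rfl | ⟨a₀, -⟩
  · simp
  have : Nonempty α := ⟨a₀⟩
  have h0 : ∀ c ∈ g '' S, ∃ a ∈ S, g a = c := fun c hc => hc
  choose! s hs hs' using h0
  have key : f '' S ⊆ (fun c => f (s c)) '' (g '' S) := by
    rintro _ ⟨a, ha, rfl⟩
    refine ⟨g a, ⟨a, ha, rfl⟩, ?_⟩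
    exact h _ (hs _ ⟨a, ha, rfl⟩) _ ha (hs' _ ⟨a, ha, rfl⟩)
  exact (ncard_le_ncard key (hg.image _)).trans (ncard_image_le hg)

theorem ncard_image_eq_of_iff [Finite α] {S : Set α} {f : α → β} {g : α → γ}
    (h : ∀ a ∈ S, ∀ b ∈ S, f a = f b ↔ g a = g b) : (f '' S).ncard = (g '' S).ncard :=
  le_antisymm (ncard_image_le_of_imp (S.toFinite.image _) fun a ha b hb => (h a ha b hb).2)
    (ncard_image_le_of_imp (S.toFinite.image _) fun a ha b hb => (h a ha b hb).1)

theorem ncard_image_union_of_ne [Finite α] {S T : Set α} {f : α → β}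
    (h : ∀ a ∈ S, ∀ b ∈ T, f a ≠ f b) :
    (f '' (S ∪ T)).ncard = (f '' S).ncard + (f '' T).ncard := by
  rw [image_union, ncard_union_eq]
  · rw [Set.disjoint_left]
    rintro _ ⟨a, ha, rfl⟩ ⟨b, hb, hab⟩
    exact h a ha b hb hab.symm

end Set

/-! ### Powers of q modulo powers of 2 -/

section Arithmetic

theorem exists_mul_modEq_one_of_odd {r : ℕ} (hr : Odd r) (k : ℕ) :
    ∃ r', r * r' ≡ 1 [MOD 2 ^ k] := by
  -- The modulus 2^(k+1) is used because it exceeds 1 even when k = 0.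
  obtain ⟨r', -, h⟩ := Nat.exists_mul_mod_eq_one_of_coprime (n := r) (k := 2 ^ (k + 1))
    (hr.coprime_two_right.pow_right _) (Nat.one_lt_two_pow (by simp))
  refine ⟨r', ?_⟩
  have : r * r' ≡ 1 [MOD 2 ^ (k + 1)] := by
    rw [Nat.ModEq, h, Nat.mod_eq_of_lt (Nat.one_lt_two_pow (by simp))]
  exact this.of_dvd (pow_dvd_pow 2 (Nat.le_succ k))

/-- The 2-adic valuation of q^(2^(j+1)) - 1 is exactly j + 3: it is 3 for q² - 1, and each squaring
raises it by one. The odd cofactor is what permits lifting one binary digit at a time. -/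
theorem pow_two_pow_of_mod_eight_eq_three {q : ℕ} (hq : q % 8 = 3) (j : ℕ) :
    ∃ a, q ^ 2 ^ (j + 1) = 1 + 2 ^ (j + 3) * (2 * a + 1) := by
  induction j with
  | zero =>
    obtain ⟨c, rfl⟩ : ∃ c, q = 8 * c + 3 := ⟨q / 8, by omega⟩
    exact ⟨4 * c ^ 2 + 3 * c, by ring⟩
  | succ j ih =>
    obtain ⟨a, ha⟩ := ih
    refine ⟨a + 2 ^ (j + 1) * (2 * a + 1) ^ 2, ?_⟩
    rw [pow_succ 2 (j + 1), pow_mul, ha]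
    ring

/-- For `q ≡ 3 mod 8`, congruences `w * q ^ i ≡ u` can be lifted from `8` to powers of two. -/
theorem exists_mul_pow_modEq {q w u : ℕ} (hq : q % 8 = 3) (hw : Odd w)
    (h : ∃ i, w * q ^ i ≡ u [MOD 8]) (k : ℕ) : ∃ i, w * q ^ i ≡ u [MOD 2 ^ (k + 3)] := by
  induction k with
  | zero => simpa using h
  | succ k ih =>
    obtain ⟨i, hi⟩ := ih
    by_cases hi' : w * q ^ i ≡ u [MOD 2 ^ (k + 1 + 3)]
    · exact ⟨i, hi'⟩
    obtain ⟨a, ha⟩ := pow_two_pow_of_mod_eight_eq_three hq k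
    -- The extra factor is 1 + 2^(k+3)·odd, so it changes precisely the digit in which the odd
    -- number w * q^i still differs from u modulo 2^(k+4).
    refine ⟨i + 2 ^ (k + 1), ?_⟩
    rw [pow_add q, ha]
    have hodd : Odd (w * q ^ i) := hw.mul (Odd.pow (Nat.odd_iff.2 (by omega)))
    obtain ⟨b, hb⟩ := hodd
    rw [← Int.natCast_modEq_iff, Int.modEq_iff_dvd] at hi hi' ⊢
    obtain ⟨c, hc⟩ := hi
    push_cast at hc hi' ⊢
    have hb' : (w : ℤ) * q ^ i = 2 * b + 1 := by exact_mod_cast hb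
    rcases Int.even_or_odd' c with ⟨d, rfl | rfl⟩
    · exact absurd ⟨d, by rw [hc]; ring⟩ hi'
    · refine ⟨d - (2 * a * b + a + b), ?_⟩
      have : (u : ℤ) = w * q ^ i + 2 ^ (k + 3) * (2 * d + 1) := by linarith
      rw [this]
      have e : (w : ℤ) * (q ^ i * (1 + 2 ^ (k + 3) * (2 * a + 1)))
        = w * q ^ i + (w * q ^ i) * (2 ^ (k + 3) * (2 * a + 1)) := by ring
      rw [e, hb']
      ring

end Arithmetic

/-! ### Cyclic subgroups and q-power orbits in 2-groups -/

section TwoGroups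

variable {B : Type*} [Group B] {k : ℕ}

theorem pow_eq_pow_of_modEq_two_pow {b : B} (hb : b ^ 2 ^ k = 1) {m n : ℕ}
    (h : m ≡ n [MOD 2 ^ k]) : b ^ m = b ^ n :=
  pow_eq_pow_iff_modEq.2 (h.of_dvd (orderOf_dvd_of_pow_eq_one hb))

theorem zpowers_eq_zpowers_iff_of_pow_two_pow {b c : B} (hb : b ^ 2 ^ k = 1) :
    Subgroup.zpowers b = Subgroup.zpowers c ↔ ∃ r, Odd r ∧ c = b ^ r := by
  constructor
  · intro h
    have hfin : IsOfFinOrder b := isOfFinOrder_iff_pow_eq_one.2 ⟨2 ^ k, by positivity, hb⟩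
    have hc : c ∈ Subgroup.zpowers b := h ▸ Subgroup.mem_zpowers c
    rw [← hfin.mem_powers_iff_mem_zpowers] at hc
    obtain ⟨n, rfl⟩ := hc
    rcases Nat.even_or_odd n with hn | hn
    -- If n is even, then b = b^(nm) with nm even is impossible for an element of even order, so b =
    -- 1 and r = 1 serves.
    · have hb' : b ∈ Subgroup.zpowers (b ^ n) := h ▸ Subgroup.mem_zpowers b
      rw [← (hfin.pow (n := n)).mem_powers_iff_mem_zpowers] at hb'
      obtain ⟨m, hm⟩ := hb'
      have h1 : b ^ (n * m) = b ^ 1 := by rw [pow_mul, pow_one]; exact hm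
      rw [pow_eq_pow_iff_modEq] at h1
      obtain ⟨j, -, hj⟩ := (Nat.dvd_prime_pow Nat.prime_two).1 (orderOf_dvd_of_pow_eq_one hb)
      rcases j with _ | j
      · have : b = 1 := by simpa using hj
        exact ⟨1, odd_one, by simp [this]⟩
      · rw [hj] at h1
        have h2 := h1.of_dvd (dvd_pow_self 2 (Nat.succ_ne_zero j))
        rw [Nat.ModEq, (hn.mul_right m).two_dvd.modEq_zero_nat] at h2
        simp at h2
    · exact ⟨n, hn, rfl⟩
  · rintro ⟨r, hr, rfl⟩
    apply le_antisymm
    · obtain ⟨r', h⟩ := exists_mul_modEq_one_of_odd hr k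
      rw [Subgroup.zpowers_le]
      have : (b ^ r) ^ r' = b := by
        rw [← pow_mul, pow_eq_pow_of_modEq_two_pow hb h, pow_one]
      have h' := Subgroup.npow_mem_zpowers (b ^ r) r'
      rwa [this] at h'
    · rw [Subgroup.zpowers_le]
      exact Subgroup.npow_mem_zpowers _ _

/-- The orbit of `b` under iterating `b ↦ b ^ q`. -/
def powOrbit (q : ℕ) (b : B) : Set B := {c | ∃ i : ℕ, c = b ^ q ^ i}

theorem mem_powOrbit_self (q : ℕ) (b : B) : b ∈ powOrbit q b := ⟨0, by simp⟩

/-- As q is invertible modulo 2^k, forward iteration is reversible and the sets `powOrbit q b` are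
the classes of an equivalence relation. -/
theorem powOrbit_eq_iff {q : ℕ} (hq : Odd q) {b c : B} (hb : b ^ 2 ^ k = 1) :
    powOrbit q b = powOrbit q c ↔ c ∈ powOrbit q b := by
  constructor
  · intro h
    exact h ▸ mem_powOrbit_self q c
  · rintro ⟨i, rfl⟩
    ext d
    constructor
    · rintro ⟨j, rfl⟩
      -- By Euler's theorem q^((φ(2^k) - 1) i) inverts q^i modulo 2^k.
      refine ⟨(Nat.totient (2 ^ k) - 1) * i + j, ?_⟩
      have h1 : q ^ i * q ^ ((Nat.totient (2 ^ k) - 1) * i + j) =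
          (q ^ Nat.totient (2 ^ k)) ^ i * q ^ j := by
        have : 1 ≤ Nat.totient (2 ^ k) := Nat.totient_pos.2 (by positivity)
        obtain ⟨t, ht⟩ := Nat.exists_eq_add_of_le this
        rw [ht, Nat.add_sub_cancel_left, ← pow_mul, ← pow_add, ← pow_add]
        congr 1
        ring
      rw [← pow_mul, h1]
      apply pow_eq_pow_of_modEq_two_pow hb
      have := (Nat.ModEq.pow_totient (hq.coprime_two_right.pow_right k)).pow i
      simpa using (this.mul_right (q ^ j)).symm
    · rintro ⟨j, rfl⟩
      exact ⟨i + j, by rw [pow_add, pow_mul]⟩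

theorem zpowers_eq_of_powOrbit_eq {q : ℕ} (hq : Odd q) {b c : B} (hb : b ^ 2 ^ k = 1)
    (h : powOrbit q b = powOrbit q c) : Subgroup.zpowers b = Subgroup.zpowers c := by
  obtain ⟨i, hi⟩ := (powOrbit_eq_iff hq hb).1 h
  exact (zpowers_eq_zpowers_iff_of_pow_two_pow hb).2 ⟨q ^ i, hq.pow, hi⟩

theorem eight_dvd_orderOf {b : B} (hb : b ^ 2 ^ k = 1) (h4 : b ^ 4 ≠ 1) : 8 ∣ orderOf b := by
  obtain ⟨j, -, hj⟩ := (Nat.dvd_prime_pow Nat.prime_two).1 (orderOf_dvd_of_pow_eq_one hb)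
  rw [hj]
  by_contra h
  have : j < 3 := by
    by_contra hj3
    exact h (pow_dvd_pow 2 (not_lt.1 hj3) : 2 ^ 3 ∣ 2 ^ j)
  apply h4
  rw [← orderOf_dvd_iff_pow_eq_one, hj]
  exact (pow_dvd_pow 2 (by omega) : 2 ^ j ∣ 2 ^ 2)

variable [Finite B]

theorem ncard_image_zpowers_le_powOrbit {q : ℕ} (hq : Odd q) (hB : ∀ b : B, b ^ 2 ^ k = 1)
    (S : Set B) : (Subgroup.zpowers '' S).ncard ≤ (powOrbit q '' S).ncard :=
  Set.ncard_image_le_of_imp (Set.toFinite _) fun a _ _ _ h => zpowers_eq_of_powOrbit_eq hq (hB a) h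

/-- Modulo 4 the exponents 1 and q ≡ 3 exhaust the odd residues. -/
theorem ncard_image_powOrbit_of_pow_four {q : ℕ} (hq : q % 4 = 3) (hB : ∀ b : B, b ^ 2 ^ k = 1)
    (S : Set B) (hS : ∀ b ∈ S, b ^ 4 = 1) :
    (powOrbit q '' S).ncard = (Subgroup.zpowers '' S).ncard := by
  have hq' : Odd q := Nat.odd_iff.2 (by omega)
  refine Set.ncard_image_eq_of_iff fun a ha b _ => ?_
  refine ⟨zpowers_eq_of_powOrbit_eq hq' (hB a), fun h => ?_⟩
  rw [powOrbit_eq_iff hq' (hB a)]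
  obtain ⟨r, hr, rfl⟩ := (zpowers_eq_zpowers_iff_of_pow_two_pow (hB a)).1 h
  have ha4 : a ^ 2 ^ 2 = 1 := hS a ha
  have : r % 4 = 1 ∨ r % 4 = 3 := by have := Nat.odd_iff.1 hr; omega
  rcases this with h | h
  · exact ⟨0, pow_eq_pow_of_modEq_two_pow ha4 (by simpa [Nat.ModEq] using h)⟩
  · exact ⟨1, pow_eq_pow_of_modEq_two_pow ha4 (by simp [Nat.ModEq, h, hq])⟩

theorem pow_mod_eight_of_odd {q : ℕ} (hq : Odd q) (i : ℕ) : q ^ i % 8 = 1 ∨ q ^ i % 8 = q % 8 := by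
  have h8 : q % 8 = 1 ∨ q % 8 = 3 ∨ q % 8 = 5 ∨ q % 8 = 7 := by
    have := Nat.odd_iff.1 hq; omega
  induction i with
  | zero => simp
  | succ i ih =>
    rw [pow_succ, Nat.mul_mod]
    rcases ih with h | h <;> rcases h8 with h' | h' | h' | h' <;> simp [h, h']

/-- Elements of S have order divisible by 8, so exponents are determined modulo 8, where powers of q
are only 1 or q. A generator b and its power b^r, with r odd and outside {1, q} modulo 8, lie in
different orbits of the same cyclic group. -/
theorem two_mul_ncard_image_zpowers {q : ℕ} (hq : Odd q) (hB : ∀ b : B, b ^ 2 ^ k = 1)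
    (S : Set B) (hS : ∀ b ∈ S, b ^ 4 ≠ 1) (hS' : ∀ b ∈ S, ∀ r, Odd r → b ^ r ∈ S) :
    2 * (Subgroup.zpowers '' S).ncard ≤ (powOrbit q '' S).ncard ∧
    (q % 8 = 3 → (powOrbit q '' S).ncard = 2 * (Subgroup.zpowers '' S).ncard) := by
  have h0 : ∀ H ∈ Subgroup.zpowers '' S, ∃ b ∈ S, Subgroup.zpowers b = H := fun H hH => hH
  choose! b hb hbH using h0
  -- For q ≡ 3 the choice r = 5 gives the other coset of {1, 3} modulo 8; in all other cases r = 3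
  -- avoids both 1 and q.
  obtain ⟨r, hr, hr1, hrq, hr3⟩ :
      ∃ r, Odd r ∧ r % 8 ≠ 1 ∧ r % 8 ≠ q % 8 ∧ (q % 8 = 3 → r = 5) := by
    by_cases h : q % 8 = 3
    · exact ⟨5, by decide, by omega, by omega, fun _ => rfl⟩
    · exact ⟨3, by decide, by omega, by omega, fun h' => absurd h' h⟩
  set P := Subgroup.zpowers '' S with hP
  set X := (fun H => powOrbit q (b H)) '' P
  set Y := (fun H => powOrbit q (b H ^ r)) '' P
  have hzr : ∀ c : B, Subgroup.zpowers (c ^ r) = Subgroup.zpowers c := fun c =>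
    ((zpowers_eq_zpowers_iff_of_pow_two_pow (hB c)).2 ⟨r, hr, rfl⟩).symm
  have hX : X.ncard = P.ncard := by
    refine Set.InjOn.ncard_image fun H hH H' hH' h => ?_
    have := zpowers_eq_of_powOrbit_eq hq (hB _) h
    rwa [hbH H hH, hbH H' hH'] at this
  have hY : Y.ncard = P.ncard := by
    refine Set.InjOn.ncard_image fun H hH H' hH' h => ?_
    have := zpowers_eq_of_powOrbit_eq hq (hB _) h
    rwa [hzr, hzr, hbH H hH, hbH H' hH'] at this
  have hXY : Disjoint X Y := by
    rw [Set.disjoint_left]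
    rintro _ ⟨H, hH, rfl⟩ ⟨H', hH', h⟩
    replace h := h.symm
    have := zpowers_eq_of_powOrbit_eq hq (hB _) h
    rw [hzr, hbH H hH, hbH H' hH'] at this
    subst this
    obtain ⟨i, hi⟩ := (powOrbit_eq_iff hq (hB _)).1 h
    rw [pow_eq_pow_iff_modEq] at hi
    have := hi.of_dvd (eight_dvd_orderOf (hB _) (hS _ (hb H hH)))
    rcases pow_mod_eight_of_odd hq i with h1 | h1 <;> rw [Nat.ModEq, h1] at this
    · exact hr1 this
    · exact hrq this
  have hPfin : P.Finite := S.toFinite.image _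
  have hun : (X ∪ Y).ncard = 2 * P.ncard := by
    rw [Set.ncard_union_eq hXY (hPfin.image _) (hPfin.image _), hX, hY, two_mul]
  rw [← hun]
  refine ⟨Set.ncard_le_ncard ?_ (S.toFinite.image _), fun hq3 => congrArg _ ?_⟩
  · rintro _ (⟨H, hH, rfl⟩ | ⟨H, hH, rfl⟩)
    · exact ⟨_, hb H hH, rfl⟩
    · exact ⟨_, hS' _ (hb H hH) r hr, rfl⟩
  · apply Set.Subset.antisymm
    · rintro _ ⟨c, hc, rfl⟩
      have hcP : Subgroup.zpowers c ∈ P := ⟨c, hc, rfl⟩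
      obtain ⟨u, hu, hcu⟩ := (zpowers_eq_zpowers_iff_of_pow_two_pow (hB _)).1 (hbH _ hcP)
      have hr5 := hr3 hq3
      subst hr5
      have h8 : u % 8 = 1 ∨ u % 8 = 3 ∨ u % 8 = 5 ∨ u % 8 = 7 := by
        have := Nat.odd_iff.1 hu; omega
      have key : ∀ w, Odd w → (∃ i, w * q ^ i ≡ u [MOD 8]) →
          powOrbit q (b (Subgroup.zpowers c) ^ w) = powOrbit q c := by
        intro w hw h
        obtain ⟨i, hi⟩ := exists_mul_pow_modEq hq3 hw h k
        rw [powOrbit_eq_iff hq (hB _)]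
        refine ⟨i, ?_⟩
        rw [← pow_mul]
        conv_lhs => rw [hcu]
        exact (pow_eq_pow_of_modEq_two_pow (hB _)
          (hi.of_dvd (pow_dvd_pow 2 (Nat.le_add_right k 3)))).symm
      -- Exponents 1 and 3 are reached from the chosen generator, 5 and 7 ≡ 5 · 3 from its fifth
      -- power.
      rcases h8 with h | h | h | h
      · exact Or.inl ⟨_, hcP, by simpa using key 1 odd_one ⟨0, by simp [Nat.ModEq, h]⟩⟩
      · exact Or.inl ⟨_, hcP, by simpa using key 1 odd_one ⟨1, by simp [Nat.ModEq, h, hq3]⟩⟩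
      · exact Or.inr ⟨_, hcP, key 5 hr ⟨0, by simp [Nat.ModEq, h]⟩⟩
      · exact Or.inr ⟨_, hcP, key 5 hr ⟨1, by simp [Nat.ModEq, Nat.mul_mod, h, hq3]⟩⟩
    · rintro _ (⟨H, hH, rfl⟩ | ⟨H, hH, rfl⟩)
      · exact ⟨_, hb H hH, rfl⟩
      · exact ⟨_, hS' _ (hb H hH) r hr, rfl⟩

end TwoGroups

/-! ### Maximal ideals of abelian group algebras as Galois orbits of characters -/

section Characters

variable (K : Type v) [Field K] (A : Type u) [CommGroup A]

instance MonoidAlgebra.isArtinianRing_of_finite [Finite A] : IsArtinianRing (MonoidAlgebra K A) :=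
  have : Module.Finite K (MonoidAlgebra K A) := inferInstance
  IsArtinianRing.of_finite K _

variable {A} in
/-- The extension of a character of `A` to the group algebra. -/
noncomputable def charAlgHom (χ : A →* (AlgebraicClosure K)ˣ) :
    MonoidAlgebra K A →ₐ[K] AlgebraicClosure K :=
  MonoidAlgebra.lift K (AlgebraicClosure K) A ((Units.coeHom (AlgebraicClosure K)).comp χ)

variable {K A}

@[simp]
theorem charAlgHom_single (χ : A →* (AlgebraicClosure K)ˣ) (a : A) (c : K) :
    charAlgHom K χ (MonoidAlgebra.single a c) = c • (χ a : AlgebraicClosure K) := by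
  simp [charAlgHom]

variable [Finite A]

/-- The maximal ideal of the group algebra defined by a character. -/
noncomputable def charIdeal (χ : A →* (AlgebraicClosure K)ˣ) :
    MaximalSpectrum (MonoidAlgebra K A) :=
  ⟨RingHom.ker (charAlgHom K χ), have := RingHom.ker_isPrime (charAlgHom K χ)
    IsArtinianRing.isMaximal_of_isPrime _⟩

theorem mem_charIdeal (χ : A →* (AlgebraicClosure K)ˣ) (r : MonoidAlgebra K A) :
    r ∈ (charIdeal χ).asIdeal ↔ charAlgHom K χ r = 0 := Iff.rfl

/-- The residue field is finite over K, hence embeds into the algebraic closure; the embedding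
restricted to A is the character. -/
theorem charIdeal_surjective : Function.Surjective (charIdeal (K := K) (A := A)) := by
  intro m
  let := Ideal.Quotient.field m.asIdeal
  have : Module.Finite K (MonoidAlgebra K A) := inferInstance
  have : Module.Finite K (MonoidAlgebra K A ⧸ m.asIdeal) := inferInstance
  let f : (MonoidAlgebra K A ⧸ m.asIdeal) →ₐ[K] (AlgebraicClosure K) := IsAlgClosed.lift
  let χ : A →* (AlgebraicClosure K)ˣ := ((f.comp (Ideal.Quotient.mkₐ K m.asIdeal) :
    MonoidAlgebra K A →* (AlgebraicClosure K)).comp (MonoidAlgebra.of K A)).toHomUnits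
  have hχ : charAlgHom K χ = f.comp (Ideal.Quotient.mkₐ K m.asIdeal) := by
    apply MonoidAlgebra.algHom_ext
    · intro a
      simp [χ, charAlgHom]
    · exact Subsingleton.elim _ _
  refine ⟨χ, MaximalSpectrum.ext (Ideal.ext fun r => ?_)⟩
  rw [mem_charIdeal, hχ]
  simp [Ideal.Quotient.eq_zero_iff_mem]

/-- Characters with the same kernel ideal give two embeddings of one residue field into the
algebraic closure, and these differ by a K-endomorphism. -/
theorem charIdeal_eq_iff (χ ψ : A →* (AlgebraicClosure K)ˣ) :
    charIdeal χ = charIdeal ψ ↔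
      ∃ σ : AlgebraicClosure K →ₐ[K] AlgebraicClosure K, ∀ a, σ (χ a) = ψ a := by
  constructor
  · intro h
    let m := charIdeal χ
    let _ := Ideal.Quotient.field m.asIdeal
    have : Module.Finite K (MonoidAlgebra K A) := inferInstance
    let f : (MonoidAlgebra K A ⧸ m.asIdeal) →ₐ[K] (AlgebraicClosure K) :=
      Ideal.Quotient.liftₐ m.asIdeal (charAlgHom K χ) fun r hr => hr
    let g : (MonoidAlgebra K A ⧸ m.asIdeal) →ₐ[K] (AlgebraicClosure K) :=
      Ideal.Quotient.liftₐ m.asIdeal (charAlgHom K ψ) fun r hr => by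
        rw [← mem_charIdeal, ← h]; exact hr
    -- The closure is regarded as an extension of the residue field through χ, so that the embedding
    -- through ψ extends to it.
    let : Algebra (MonoidAlgebra K A ⧸ m.asIdeal) (AlgebraicClosure K) := f.toRingHom.toAlgebra
    have : IsScalarTower K (MonoidAlgebra K A ⧸ m.asIdeal) (AlgebraicClosure K) :=
      IsScalarTower.of_algebraMap_eq fun c => (f.commutes c).symm
    have : Algebra.IsAlgebraic (MonoidAlgebra K A ⧸ m.asIdeal) (AlgebraicClosure K) :=
      Algebra.IsAlgebraic.tower_top (K := K) _
    obtain ⟨σ, hσ⟩ := IsAlgClosed.surjective_domRestrict_of_isAlgebraic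
      (K := K) (L := MonoidAlgebra K A ⧸ m.asIdeal) (M := AlgebraicClosure K)
      (E := AlgebraicClosure K) g
    refine ⟨σ, fun a => ?_⟩
    have h1 := DFunLike.congr_fun hσ (Ideal.Quotient.mk _ (MonoidAlgebra.single a 1))
    have h2 : algebraMap (MonoidAlgebra K A ⧸ m.asIdeal) (AlgebraicClosure K)
        (Ideal.Quotient.mk _ (MonoidAlgebra.single a 1)) = χ a := by
      change charAlgHom K χ _ = _
      simp
    have h3 : g (Ideal.Quotient.mk _ (MonoidAlgebra.single a 1)) = ψ a := by
      change charAlgHom K ψ _ = _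
      simp
    rw [h3] at h1
    rw [← h1, ← h2]
    rfl
  · rintro ⟨σ, hσ⟩
    have : charAlgHom K ψ = σ.comp (charAlgHom K χ) := by
      apply MonoidAlgebra.algHom_ext
      · intro a
        simp [hσ]
      · exact Subsingleton.elim _ _
    refine MaximalSpectrum.ext (Ideal.ext fun r => ?_)
    rw [mem_charIdeal, mem_charIdeal, this]
    simp

theorem card_maximalSpectrum_subtype (P : MaximalSpectrum (MonoidAlgebra K A) → Prop) :
    Nat.card {m // P m} = (charIdeal '' {χ : A →* (AlgebraicClosure K)ˣ | P (charIdeal χ)}).ncard := by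
  rw [← Nat.card_coe_set_eq]
  refine Nat.card_congr (Equiv.subtypeEquivRight fun m => ?_)
  constructor
  · intro hm
    obtain ⟨χ, rfl⟩ := charIdeal_surjective m
    exact ⟨χ, hm, rfl⟩
  · rintro ⟨χ, hχ, rfl⟩
    exact hχ

omit [Finite A] in
-- The order 2^(k+1), rather than 2^k, is even also for k = 0, so an exponent coprime to it is odd.
theorem exists_primitiveRoot_forall_pow [NeZero (2 : K)] {k : ℕ} (hA : ∀ a : A, a ^ 2 ^ k = 1) :
    ∃ ζ : AlgebraicClosure K, IsPrimitiveRoot ζ (2 ^ (k + 1)) ∧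
      ∀ (χ : A →* (AlgebraicClosure K)ˣ) (a : A), ∃ i : ℕ, (χ a : AlgebraicClosure K) = ζ ^ i := by
  have : NeZero ((2 : ℕ) : K) := by simpa using ‹NeZero (2 : K)›
  obtain ⟨ζ, hζ⟩ := HasEnoughRootsOfUnity.exists_primitiveRoot (AlgebraicClosure K) (2 ^ (k + 1))
  refine ⟨ζ, hζ, fun χ a => ?_⟩
  obtain ⟨i, -, hi⟩ := hζ.eq_pow_of_pow_eq_one (ξ := (χ a : AlgebraicClosure K)) (by
    rw [← Units.val_pow_eq_pow_val, ← map_pow, pow_succ, pow_mul, hA]; simp)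
  exact ⟨i, hi.symm⟩

/-- Irreducibility of the cyclotomic polynomials makes ζ ↦ ζ^r an automorphism for every odd r. -/
theorem charIdeal_eq_iff_zpowers_eq [NeZero (2 : K)]
    (hK : ∀ n, Irreducible (Polynomial.cyclotomic (2 ^ n) K)) {k : ℕ} (hA : ∀ a : A, a ^ 2 ^ k = 1)
    (χ ψ : A →* (AlgebraicClosure K)ˣ) :
    charIdeal χ = charIdeal ψ ↔ Subgroup.zpowers χ = Subgroup.zpowers ψ := by
  have hχ : χ ^ 2 ^ k = 1 := by
    ext a
    simp [← map_pow, hA]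
  rw [charIdeal_eq_iff, zpowers_eq_zpowers_iff_of_pow_two_pow hχ]
  obtain ⟨ζ, hζ, hex⟩ := exists_primitiveRoot_forall_pow (K := K) hA
  constructor
  · rintro ⟨σ, hσ⟩
    have h1 : IsPrimitiveRoot (σ ζ) (2 ^ (k + 1)) := hζ.map_of_injective σ.injective
    obtain ⟨r, -, hr⟩ := hζ.eq_pow_of_pow_eq_one h1.pow_eq_one
    rw [← hr, hζ.pow_iff_coprime (by positivity)] at h1
    refine ⟨r, Nat.coprime_two_right.1 (h1.coprime_dvd_right (dvd_pow_self 2 (by simp))), ?_⟩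
    ext a
    obtain ⟨i, hi⟩ := hex χ a
    rw [← hσ, hi, map_pow, ← hr]
    simp [hi, ← pow_mul, mul_comm]
  · rintro ⟨r, hr, rfl⟩
    have h1 : IsPrimitiveRoot (ζ ^ r) (2 ^ (k + 1)) :=
      hζ.pow_of_coprime r (hr.coprime_two_right.pow_right _)
    obtain ⟨σ, hσ⟩ := minpoly.exists_algEquiv_of_root' (K := K) (x := ζ ^ r) (y := ζ)
      (Algebra.IsAlgebraic.isAlgebraic ζ) (by
        have : NeZero ((2 ^ (k + 1) : ℕ) : K) := ⟨by simpa using NeZero.ne (2 : K)⟩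
        rw [← hζ.minpoly_eq_cyclotomic_of_irreducible (hK _),
          h1.minpoly_eq_cyclotomic_of_irreducible (hK _)]
        exact minpoly.aeval _ _)
    refine ⟨σ, fun a => ?_⟩
    obtain ⟨i, hi⟩ := hex χ a
    simp [hi, hσ, ← pow_mul, mul_comm]

theorem charIdeal_eq_iff_powOrbit_eq [Finite K] (hK : Odd (Nat.card K)) {k : ℕ}
    (hA : ∀ a : A, a ^ 2 ^ k = 1) (χ ψ : A →* (AlgebraicClosure K)ˣ) :
    charIdeal χ = charIdeal ψ ↔ powOrbit (Nat.card K) χ = powOrbit (Nat.card K) ψ := by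
  have hχ : χ ^ 2 ^ k = 1 := by
    ext a
    simp [← map_pow, hA]
  have := Fintype.ofFinite K
  rw [charIdeal_eq_iff, powOrbit_eq_iff hK hχ, Nat.card_eq_fintype_card]
  constructor
  · rintro ⟨σ, hσ⟩
    -- The values of χ generate a finite field, on which σ must be a power of Frobenius.
    let S : Set (AlgebraicClosure K) := Set.range fun a => (χ a : AlgebraicClosure K)
    let E : IntermediateField K (AlgebraicClosure K) := IntermediateField.adjoin K S
    have : FiniteDimensional K E := IntermediateField.finiteDimensional_adjoin
      fun x _ => Algebra.IsIntegral.isIntegral x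
    have : Finite E := Module.finite_of_finite K
    obtain ⟨n, hn⟩ := (FiniteField.bijective_frobeniusAlgHom_pow K E).2 (σ.restrictNormal E)
    refine ⟨n, ?_⟩
    ext a
    have hmem : (χ a : AlgebraicClosure K) ∈ E := IntermediateField.subset_adjoin K S ⟨a, rfl⟩
    have h1 := AlgHom.restrictNormal_commutes σ E ⟨χ a, hmem⟩
    rw [← hn] at h1
    simp only [AlgHom.coe_pow, FiniteField.coe_frobeniusAlgHom, pow_iterate, map_pow] at h1
    rw [← hσ]
    simpa using h1.symm
  · rintro ⟨i, rfl⟩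
    refine ⟨FiniteField.frobeniusAlgHom K (AlgebraicClosure K) ^ i, fun a => ?_⟩
    simp [AlgHom.coe_pow, FiniteField.coe_frobeniusAlgHom, pow_iterate]

theorem card_maximalSpectrum_rat {k : ℕ} (hA : ∀ a : A, a ^ 2 ^ k = 1)
    (P : MaximalSpectrum (MonoidAlgebra ℚ A) → Prop) :
    Nat.card {m // P m} = (Subgroup.zpowers ''
      {χ : A →* (AlgebraicClosure ℚ)ˣ | P (charIdeal χ)}).ncard := by
  rw [card_maximalSpectrum_subtype]
  exact Set.ncard_image_eq_of_iff fun χ _ ψ _ => charIdeal_eq_iff_zpowers_eq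
    (fun _ => Polynomial.cyclotomic.irreducible_rat (by positivity)) hA χ ψ

theorem card_maximalSpectrum_finite [Finite K] (hK : Odd (Nat.card K)) {k : ℕ}
    (hA : ∀ a : A, a ^ 2 ^ k = 1) (P : MaximalSpectrum (MonoidAlgebra K A) → Prop) :
    Nat.card {m // P m} =
      (powOrbit (Nat.card K) '' {χ : A →* (AlgebraicClosure K)ˣ | P (charIdeal χ)}).ncard := by
  rw [card_maximalSpectrum_subtype]
  exact Set.ncard_image_eq_of_iff fun χ _ ψ _ => charIdeal_eq_iff_powOrbit_eq hK hA χ ψ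

theorem monoidHom_mulEquiv_of_two_group [NeZero (2 : K)] {k : ℕ} (hA : ∀ a : A, a ^ 2 ^ k = 1) :
    Nonempty ((A →* (AlgebraicClosure K)ˣ) ≃* A) := by
  have : NeZero ((2 : ℕ) : K) := by simpa using ‹NeZero (2 : K)›
  have : HasEnoughRootsOfUnity (AlgebraicClosure K) (Monoid.exponent A) :=
    HasEnoughRootsOfUnity.of_dvd (n := 2 ^ k) (AlgebraicClosure K)
      (Monoid.exponent_dvd_of_forall_pow_eq_one hA)
  exact CommGroup.monoidHom_mulEquiv_of_hasEnoughRootsOfUnity A (AlgebraicClosure K)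

end Characters

/-- Generators `x, y` of a group of type `D₄`, where the two central generators are eliminated. -/
structure IsD4Pair (m₁ m₂ : ℕ) {G : Type u} [Group G] (x y : G) : Prop where
  pow_x : x ^ 2 ^ (m₁ + 1) = 1
  pow_y : y ^ 2 ^ (m₂ + 1) = 1
  commute_sq_x : Commute (x ^ 2) y
  commute_sq_y : Commute (y ^ 2) x
  comm : x⁻¹ * y⁻¹ * x * y = x ^ 2 ^ m₁

/-! ### The presentation on two generators and its universal property -/

namespace D4Group

variable {m₁ m₂ : ℕ}

local notation "X" => (PresentedGroup.of D4Gen.x : D4Group m₁ m₂)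
local notation "Y" => (PresentedGroup.of D4Gen.y : D4Group m₁ m₂)

theorem sq_x : X ^ 2 = PresentedGroup.of D4Gen.t₁ := by
  have := PresentedGroup.one_of_mem (rels := D4Gen.relators m₁ m₂)
    (x := FreeGroup.of D4Gen.x ^ 2 * (FreeGroup.of D4Gen.t₁)⁻¹) (by simp [D4Gen.relators])
  simpa [PresentedGroup.of, mul_inv_eq_one] using this

theorem sq_y : Y ^ 2 = PresentedGroup.of D4Gen.t₂ := by
  have := PresentedGroup.one_of_mem (rels := D4Gen.relators m₁ m₂)
    (x := FreeGroup.of D4Gen.y ^ 2 * (FreeGroup.of D4Gen.t₂)⁻¹) (by simp [D4Gen.relators])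
  simpa [PresentedGroup.of, mul_inv_eq_one] using this

theorem isD4Pair (hm₁ : 1 ≤ m₁) : IsD4Pair m₁ m₂ X Y where
  pow_x := by
    have := PresentedGroup.one_of_mem (rels := D4Gen.relators m₁ m₂)
      (x := FreeGroup.of D4Gen.t₁ ^ 2 ^ m₁) (by simp [D4Gen.relators])
    rw [pow_succ', pow_mul, sq_x]
    simpa [PresentedGroup.of] using this
  pow_y := by
    have := PresentedGroup.one_of_mem (rels := D4Gen.relators m₁ m₂)
      (x := FreeGroup.of D4Gen.t₂ ^ 2 ^ m₂) (by simp [D4Gen.relators])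
    rw [pow_succ', pow_mul, sq_y]
    simpa [PresentedGroup.of] using this
  commute_sq_x := by
    have := PresentedGroup.one_of_mem (rels := D4Gen.relators m₁ m₂)
      (x := D4Gen.comm (FreeGroup.of D4Gen.t₁) (FreeGroup.of D4Gen.y))
      (Or.inl (Or.inr ⟨_, rfl⟩))
    rw [sq_x, commute_iff_eq]
    simp only [D4Gen.comm, map_mul, map_inv, mul_assoc, inv_mul_eq_one] at this
    rw [eq_inv_mul_iff_mul_eq] at this
    exact this.symm
  commute_sq_y := by
    have := PresentedGroup.one_of_mem (rels := D4Gen.relators m₁ m₂)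
      (x := D4Gen.comm (FreeGroup.of D4Gen.t₂) (FreeGroup.of D4Gen.x))
      (Or.inr ⟨_, rfl⟩)
    rw [sq_y, commute_iff_eq]
    simp only [D4Gen.comm, map_mul, map_inv, mul_assoc, inv_mul_eq_one] at this
    rw [eq_inv_mul_iff_mul_eq] at this
    exact this.symm
  comm := by
    have := PresentedGroup.one_of_mem (rels := D4Gen.relators m₁ m₂)
      (x := D4Gen.comm (FreeGroup.of D4Gen.x) (FreeGroup.of D4Gen.y) *
        (FreeGroup.of D4Gen.t₁ ^ 2 ^ (m₁ - 1))⁻¹) (by simp [D4Gen.relators])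
    obtain ⟨n, rfl⟩ := Nat.exists_eq_add_of_le' hm₁
    rw [pow_succ' 2 n, pow_mul, sq_x]
    simpa [PresentedGroup.of, D4Gen.comm, mul_inv_eq_one] using this

theorem closure_eq_top : Subgroup.closure {X, Y} = ⊤ := by
  rw [eq_top_iff, ← PresentedGroup.closure_range_of, Subgroup.closure_le]
  have hX : X ∈ Subgroup.closure {X, Y} := Subgroup.subset_closure (by simp)
  have hY : Y ∈ Subgroup.closure {X, Y} := Subgroup.subset_closure (by simp)
  rintro _ ⟨g, rfl⟩
  cases g
  · exact hX
  · exact hY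
  · exact sq_x (m₁ := m₁) (m₂ := m₂) ▸ pow_mem hX 2
  · exact sq_y (m₁ := m₁) (m₂ := m₂) ▸ pow_mem hY 2

theorem exists_monoidHom (hm₁ : 1 ≤ m₁) {H : Type w} [Group H] {a b : H}
    (h : IsD4Pair m₁ m₂ a b) : ∃ f : D4Group m₁ m₂ →* H, f X = a ∧ f Y = b := by
  let f : D4Gen → H := fun g => match g with
    | .x => a
    | .y => b
    | .t₁ => a ^ 2
    | .t₂ => b ^ 2
  have hcomm : ∀ g k : D4Gen, Commute (f g) (f k) →
      FreeGroup.lift f (D4Gen.comm (FreeGroup.of g) (FreeGroup.of k)) = 1 := by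
    intro g k hgk
    simp only [D4Gen.comm, map_mul, map_inv, FreeGroup.lift_apply_of, mul_assoc]
    rw [inv_mul_eq_one, eq_inv_mul_iff_mul_eq]
    exact hgk.eq.symm
  have hf : ∀ r ∈ D4Gen.relators m₁ m₂, FreeGroup.lift f r = 1 := by
    rintro r ((hr | ⟨g, rfl⟩) | ⟨g, rfl⟩)
    · obtain ⟨n, rfl⟩ := Nat.exists_eq_add_of_le' hm₁
      rcases hr with rfl | rfl | rfl | rfl | rfl
      · simpa [f, ← pow_mul, ← pow_succ'] using h.pow_x
      · simpa [f, ← pow_mul, ← pow_succ'] using h.pow_y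
      · simp [f]
      · simp [f]
      · have := h.comm
        rw [pow_succ' 2 n, pow_mul] at this
        simp [f, D4Gen.comm, this]
    · apply hcomm
      cases g
      · exact (Commute.refl a).pow_left 2
      · exact h.commute_sq_x
      · exact Commute.refl _
      · exact h.commute_sq_x.pow_right 2
    · apply hcomm
      cases g
      · exact h.commute_sq_y
      · exact (Commute.refl b).pow_left 2
      · exact h.commute_sq_y.pow_right 2
      · exact Commute.refl _
  exact ⟨PresentedGroup.toGroup hf, PresentedGroup.toGroup.of hf, PresentedGroup.toGroup.of hf⟩

end D4Group

/-- The data of a group of type `D₄` with its two generators. -/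
structure IsD4 (m₁ m₂ : ℕ) {G : Type u} [Group G] (x y : G) : Prop where
  one_le : 1 ≤ m₁
  exists_equiv : ∃ φ : D4Group m₁ m₂ ≃* G,
    φ (PresentedGroup.of D4Gen.x) = x ∧ φ (PresentedGroup.of D4Gen.y) = y

/-! ### Quaternion generators satisfying the group relations -/

namespace QuaternionAlgebra

variable {L : Type w} [CommRing L] (a b : L)

/-- The first standard generator. -/
def genI : ℍ[L, a, b] := ⟨0, 1, 0, 0⟩

/-- The second standard generator. -/
def genJ : ℍ[L, a, b] := ⟨0, 0, 1, 0⟩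

theorem genI_sq : genI a b ^ 2 = algebraMap L _ a := by
  rw [sq]; ext <;> simp [genI, algebraMap_eq]

theorem genJ_sq : genJ a b ^ 2 = algebraMap L _ b := by
  rw [sq]; ext <;> simp [genJ, algebraMap_eq]

theorem genI_mul_genJ : genI a b * genJ a b = - (genJ a b * genI a b) := by
  ext <;> simp [genI, genJ]

variable {a b}

/-- With i² = a, the element i^(2^m₁) is a^(2^(m₁-1)) = -1, which is the commutator of the
anticommuting i and j. -/
theorem isD4Pair_units {m₁ m₂ : ℕ} (hm₁ : 1 ≤ m₁) (ha : a ^ 2 ^ (m₁ - 1) = -1)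
    (hb : b ^ 2 ^ m₂ = 1) : ∃ i j : (ℍ[L, a, b])ˣ, (i : ℍ[L, a, b]) = genI a b ∧
      (j : ℍ[L, a, b]) = genJ a b ∧ IsD4Pair m₁ m₂ i j := by
  obtain ⟨n, rfl⟩ := Nat.exists_eq_add_of_le' hm₁
  have hi : genI a b ^ 2 ^ (n + 1) = -1 := by
    rw [pow_succ' 2 n, pow_mul, genI_sq, ← map_pow]
    rw [Nat.add_sub_cancel] at ha
    rw [ha, map_neg, map_one]
  have hi' : genI a b ^ 2 ^ (n + 1 + 1) = 1 := by
    rw [pow_succ 2 (n + 1), pow_mul, hi]; simp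
  have hj : genJ a b ^ 2 ^ (m₂ + 1) = 1 := by
    rw [pow_succ' 2 m₂, pow_mul, genJ_sq, ← map_pow, hb, map_one]
  refine ⟨Units.ofPowEqOne _ _ hi' (by positivity), Units.ofPowEqOne _ _ hj (by positivity),
    rfl, rfl, ?_, ?_, ?_, ?_, ?_⟩
  · exact Units.ext hi'
  · exact Units.ext hj
  · apply Units.ext
    change genI a b ^ 2 * genJ a b = genJ a b * genI a b ^ 2
    rw [genI_sq, Algebra.commutes]
  · apply Units.ext
    change genJ a b ^ 2 * genI a b = genI a b * genJ a b ^ 2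
    rw [genJ_sq, Algebra.commutes]
  · rw [mul_assoc, mul_assoc, inv_mul_eq_iff_eq_mul, inv_mul_eq_iff_eq_mul]
    apply Units.ext
    change genI a b * genJ a b = genJ a b * (genI a b * genI a b ^ 2 ^ (n + 1))
    rw [hi, genI_mul_genJ]
    simp

end QuaternionAlgebra

/-! ### Structure of the group: normal form, centre, abelianization -/

namespace IsD4

variable {m₁ m₂ : ℕ} {G : Type u} [Group G] {x y : G}

theorem isD4Pair (h : IsD4 m₁ m₂ x y) : IsD4Pair m₁ m₂ x y := by
  obtain ⟨h1, φ, rfl, rfl⟩ := h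
  have h := D4Group.isD4Pair (m₂ := m₂) h1
  constructor
  · rw [← map_pow, h.pow_x, map_one]
  · rw [← map_pow, h.pow_y, map_one]
  · rw [← map_pow]; exact h.commute_sq_x.map φ
  · rw [← map_pow]; exact h.commute_sq_y.map φ
  · simp only [← map_pow, ← map_mul, ← map_inv, h.comm]

theorem closure_eq_top (h : IsD4 m₁ m₂ x y) : Subgroup.closure {x, y} = ⊤ := by
  obtain ⟨h1, φ, rfl, rfl⟩ := h
  have := congrArg (Subgroup.map φ.toMonoidHom) (D4Group.closure_eq_top (m₁ := m₁) (m₂ := m₂))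
  rw [MonoidHom.map_closure, Subgroup.map_top_of_surjective _ φ.surjective] at this
  simpa [Set.image_pair] using this

theorem exists_monoidHom (h : IsD4 m₁ m₂ x y) {H : Type w} [Group H] {a b : H}
    (hab : IsD4Pair m₁ m₂ a b) : ∃ f : G →* H, f x = a ∧ f y = b := by
  obtain ⟨h1, φ, rfl, rfl⟩ := h
  obtain ⟨f, hx, hy⟩ := D4Group.exists_monoidHom h1 hab
  exact ⟨f.comp φ.symm.toMonoidHom, by simpa using hx, by simpa using hy⟩

theorem exists_monoidHom_quaternion (h : IsD4 m₁ m₂ x y) {L : Type w} [CommRing L] {a b : L}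
    (ha : a ^ 2 ^ (m₁ - 1) = -1) (hb : b ^ 2 ^ m₂ = 1) :
    ∃ f : G →* ℍ[L, a, b], f x = QuaternionAlgebra.genI a b ∧ f y = QuaternionAlgebra.genJ a b := by
  obtain ⟨i, j, hi, hj, hij⟩ := QuaternionAlgebra.isD4Pair_units h.one_le ha hb
  obtain ⟨f, hx, hy⟩ := h.exists_monoidHom hij
  exact ⟨(Units.coeHom _).comp f, by simp [hx, hi], by simp [hy, hj]⟩

section

variable (h : IsD4 m₁ m₂ x y)
include h

/-- A quaternion representation over the algebraic closure of ℚ sends this element to -1, so the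
presentation does not collapse it. -/
theorem pow_ne_one : x ^ 2 ^ m₁ ≠ 1 := by
  intro h1
  obtain ⟨n, rfl⟩ := Nat.exists_eq_add_of_le' h.one_le
  obtain ⟨ζ, hζ⟩ := HasEnoughRootsOfUnity.exists_primitiveRoot (AlgebraicClosure ℚ) (2 ^ (n + 1))
  have hζ' : ζ ^ 2 ^ n = -1 := by
    have : (ζ ^ 2 ^ n) ^ 2 = 1 := by rw [← pow_mul, ← pow_succ, hζ.pow_eq_one]
    rcases sq_eq_sq_iff_eq_or_eq_neg.1 (this.trans (one_pow 2).symm) with h' | h'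
    · exact absurd h' (hζ.pow_ne_one_of_pos_of_lt (by positivity) (by gcongr <;> simp))
    · exact h'
  obtain ⟨f, hx, -⟩ := h.exists_monoidHom_quaternion (a := ζ) (b := 1) (by simpa using hζ') (by simp)
  have := congrArg f h1
  rw [map_pow, hx, map_one, pow_succ' 2 n, pow_mul, QuaternionAlgebra.genI_sq, ← map_pow, hζ'] at this
  have := congrArg QuaternionAlgebra.re this
  simp [QuaternionAlgebra.algebraMap_eq] at this
  norm_num at this

theorem commute_sq_x (g : G) : Commute (x ^ 2) g := by
  have : g ∈ Subgroup.closure {x, y} := h.closure_eq_top ▸ Subgroup.mem_top g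
  induction this using Subgroup.closure_induction with
  | mem g hg =>
    rcases hg with rfl | rfl
    · exact (Commute.refl _).pow_left 2
    · exact h.isD4Pair.commute_sq_x
  | one => exact Commute.one_right _
  | mul a b _ _ ha hb => exact ha.mul_right hb
  | inv a _ ha => exact ha.inv_right

theorem commute_sq_y (g : G) : Commute (y ^ 2) g := by
  have : g ∈ Subgroup.closure {x, y} := h.closure_eq_top ▸ Subgroup.mem_top g
  induction this using Subgroup.closure_induction with
  | mem g hg =>
    rcases hg with rfl | rfl
    · exact h.isD4Pair.commute_sq_y
    · exact (Commute.refl _).pow_left 2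
  | one => exact Commute.one_right _
  | mul a b _ _ ha hb => exact ha.mul_right hb
  | inv a _ ha => exact ha.inv_right

theorem pow_two_pow_mul_self : x ^ 2 ^ m₁ * x ^ 2 ^ m₁ = 1 := by
  rw [← pow_add, ← two_mul, ← pow_succ', h.isD4Pair.pow_x]

theorem commute_pow (g : G) : Commute (x ^ 2 ^ m₁) g := by
  obtain ⟨n, rfl⟩ := Nat.exists_eq_add_of_le' h.one_le
  rw [pow_succ' 2 n, pow_mul]
  exact (h.commute_sq_x g).pow_left _

theorem mul_comm_eq : y * x = x * y * x ^ 2 ^ m₁ := by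
  have := h.isD4Pair.comm
  rw [mul_assoc, mul_assoc, inv_mul_eq_iff_eq_mul, inv_mul_eq_iff_eq_mul] at this
  rw [this, mul_assoc, mul_assoc, h.pow_two_pow_mul_self, mul_one]

theorem mul_pow_comm_eq (i : ℕ) : y * x ^ i = x ^ i * y * (x ^ 2 ^ m₁) ^ i := by
  induction i with
  | zero => simp
  | succ i ih =>
    rw [pow_succ, ← mul_assoc, ih, mul_assoc, ((h.commute_pow x).pow_left i).eq, ← mul_assoc,
      mul_assoc (x ^ i) y x, h.mul_comm_eq, pow_succ']
    simp only [mul_assoc]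

theorem exists_eq_pow_mul_pow (g : G) : ∃ i j : ℕ, g = x ^ i * y ^ j := by
  have : g ∈ Subgroup.closure {x, y} := h.closure_eq_top ▸ Subgroup.mem_top g
  have hX : ∀ i j : ℕ, ∃ i' j' : ℕ, x * (x ^ i * y ^ j) = x ^ i' * y ^ j' :=
    fun i j => ⟨i + 1, j, by rw [pow_succ', mul_assoc]⟩
  have hY : ∀ i j : ℕ, ∃ i' j' : ℕ, y * (x ^ i * y ^ j) = x ^ i' * y ^ j' := fun i j =>
    -- Moving y past x^i costs s^i = x^(2^m₁ * i).
    ⟨2 ^ m₁ * i + i, j + 1, by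
      rw [← mul_assoc, h.mul_pow_comm_eq, ← ((h.commute_pow _).pow_left i).eq, pow_succ', pow_add,
        pow_mul]
      simp only [mul_assoc]⟩
  have hpow : ∀ z : G, (∀ i j : ℕ, ∃ i' j' : ℕ, z * (x ^ i * y ^ j) = x ^ i' * y ^ j') →
      ∀ n i j : ℕ, ∃ i' j' : ℕ, z ^ n * (x ^ i * y ^ j) = x ^ i' * y ^ j' := by
    intro z hz n
    induction n with
    | zero => exact fun i j => ⟨i, j, by simp⟩
    | succ n ih =>
      intro i j
      obtain ⟨i', j', h1⟩ := hz i j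
      obtain ⟨i'', j'', h2⟩ := ih i' j'
      exact ⟨i'', j'', by rw [pow_succ, mul_assoc, h1, h2]⟩
  have hinv : ∀ (z : G) (n : ℕ), z ^ 2 ^ n = 1 → z⁻¹ = z ^ (2 ^ n - 1) := by
    intro z n hz
    rw [inv_eq_iff_mul_eq_one, ← pow_succ', Nat.sub_add_cancel Nat.one_le_two_pow, hz]
  induction this using Subgroup.closure_induction_left with
  | one => exact ⟨0, 0, by simp⟩
  | mul_left a ha b hb ih =>
    obtain ⟨i, j, rfl⟩ := ih
    rcases ha with rfl | rfl
    · exact hX i j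
    · exact hY i j
  | inv_mul_cancel a ha b hb ih =>
    obtain ⟨i, j, rfl⟩ := ih
    rcases ha with rfl | rfl
    · rw [hinv _ _ h.isD4Pair.pow_x]
      exact hpow _ hX _ i j
    · rw [hinv _ _ h.isD4Pair.pow_y]
      exact hpow _ hY _ i j

theorem finite : Finite G := by
  let f : Fin (2 ^ (m₁ + 1)) × Fin (2 ^ (m₂ + 1)) → G := fun p => x ^ (p.1 : ℕ) * y ^ (p.2 : ℕ)
  refine Finite.of_surjective f fun g => ?_
  obtain ⟨i, j, rfl⟩ := h.exists_eq_pow_mul_pow g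
  refine ⟨(⟨i % 2 ^ (m₁ + 1), Nat.mod_lt _ (by positivity)⟩,
    ⟨j % 2 ^ (m₂ + 1), Nat.mod_lt _ (by positivity)⟩), ?_⟩
  simp only [f]
  rw [pow_eq_pow_of_modEq_two_pow h.isD4Pair.pow_x (Nat.mod_modEq i _),
    pow_eq_pow_of_modEq_two_pow h.isD4Pair.pow_y (Nat.mod_modEq j _)]

theorem sq_x_mem_center : x ^ 2 ∈ Subgroup.center G :=
  Subgroup.mem_center_iff.2 fun g => ((h.commute_sq_x g).eq).symm

theorem sq_y_mem_center : y ^ 2 ∈ Subgroup.center G :=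
  Subgroup.mem_center_iff.2 fun g => ((h.commute_sq_y g).eq).symm

theorem pow_mem_center : x ^ 2 ^ m₁ ∈ Subgroup.center G :=
  Subgroup.mem_center_iff.2 fun g => ((h.commute_pow g).eq).symm

theorem not_commute : ¬ Commute x y := by
  intro hc
  have := h.isD4Pair.comm
  rw [mul_assoc, hc.eq] at this
  exact h.pow_ne_one (by rw [← this]; group)

theorem mem_center_iff (g : G) :
    g ∈ Subgroup.center G ↔ ∃ i j : ℕ, g = (x ^ 2) ^ i * (y ^ 2) ^ j := by
  constructor
  · intro hg
    obtain ⟨i, j, rfl⟩ := h.exists_eq_pow_mul_pow g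
    have hxi : ∃ i', x ^ i = (x ^ 2) ^ i' ∨ x ^ i = (x ^ 2) ^ i' * x := by
      rcases Nat.even_or_odd' i with ⟨i', rfl | rfl⟩
      · exact ⟨i', Or.inl (pow_mul _ _ _)⟩
      · exact ⟨i', Or.inr (by rw [pow_succ, pow_mul])⟩
    have hyj : ∃ j', y ^ j = (y ^ 2) ^ j' ∨ y ^ j = (y ^ 2) ^ j' * y := by
      rcases Nat.even_or_odd' j with ⟨j', rfl | rfl⟩
      · exact ⟨j', Or.inl (pow_mul _ _ _)⟩
      · exact ⟨j', Or.inr (by rw [pow_succ, pow_mul])⟩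
    obtain ⟨i', hi⟩ := hxi
    obtain ⟨j', hj⟩ := hyj
    have hX : (x ^ 2) ^ i' ∈ Subgroup.center G := pow_mem h.sq_x_mem_center _
    have hY : (y ^ 2) ^ j' ∈ Subgroup.center G := pow_mem h.sq_y_mem_center _
    rcases hi with hi | hi <;> rcases hj with hj | hj <;> rw [hi, hj] at hg ⊢
    · exact ⟨i', j', rfl⟩
    · rw [Subgroup.mul_mem_cancel_left _ hX, Subgroup.mul_mem_cancel_left _ hY] at hg
      exact absurd (Subgroup.mem_center_iff.1 hg x) h.not_commute
    · rw [Subgroup.mul_mem_cancel_right _ hY, Subgroup.mul_mem_cancel_left _ hX] at hg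
      exact absurd (Subgroup.mem_center_iff.1 hg y).symm h.not_commute
    · rw [mul_assoc, Subgroup.mul_mem_cancel_left _ hX, ← mul_assoc,
        Subgroup.mem_center_iff.1 hY x, mul_assoc, Subgroup.mul_mem_cancel_left _ hY] at hg
      have := Subgroup.mem_center_iff.1 hg x
      rw [mul_assoc] at this
      exact absurd (mul_left_cancel this) h.not_commute
  · rintro ⟨i, j, rfl⟩
    exact mul_mem (pow_mem h.sq_x_mem_center _) (pow_mem h.sq_y_mem_center _)

theorem exists_center_mul (g : G) : ∃ z ∈ Subgroup.center G,
    g = z ∨ g = z * x ∨ g = z * y ∨ g = z * (x * y) := by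
  obtain ⟨i, j, rfl⟩ := h.exists_eq_pow_mul_pow g
  have hX := fun i' => pow_mem h.sq_x_mem_center i'
  have hY := fun j' => pow_mem h.sq_y_mem_center j'
  rcases Nat.even_or_odd' i with ⟨i', rfl | rfl⟩ <;> rcases Nat.even_or_odd' j with ⟨j', rfl | rfl⟩
    <;> refine ⟨(x ^ 2) ^ i' * (y ^ 2) ^ j', mul_mem (hX i') (hY j'), ?_⟩
    <;> simp only [pow_succ _ (2 * _), pow_mul]
  · exact Or.inl trivial
  · exact Or.inr (Or.inr (Or.inl (mul_assoc _ _ _).symm))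
  · refine Or.inr (Or.inl ?_)
    rw [mul_assoc, mul_assoc, Subgroup.mem_center_iff.1 (hY j') x]
  · refine Or.inr (Or.inr (Or.inr ?_))
    rw [mul_assoc, mul_assoc, ← mul_assoc x, Subgroup.mem_center_iff.1 (hY j') x]
    simp only [mul_assoc]

omit h in
theorem isD4Pair_zmod : IsD4Pair m₁ m₂
    (Multiplicative.ofAdd ((1, 0) : ZMod (2 ^ m₁) × ZMod (2 ^ (m₂ + 1))))
    (Multiplicative.ofAdd ((0, 1) : ZMod (2 ^ m₁) × ZMod (2 ^ (m₂ + 1)))) := by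
  constructor
  · rw [← ofAdd_nsmul, ofAdd_eq_one]
    simp [pow_succ]
  · rw [← ofAdd_nsmul, ofAdd_eq_one]
    simp only [Prod.smul_mk, smul_zero, nsmul_eq_mul, mul_one, Prod.mk_eq_zero, true_and]
    exact ZMod.natCast_self _
  · exact Commute.all _ _
  · exact Commute.all _ _
  · rw [mul_comm _ (Multiplicative.ofAdd (0, 1))⁻¹, mul_assoc, mul_assoc, inv_mul_eq_iff_eq_mul,
      inv_mul_eq_iff_eq_mul, ← ofAdd_nsmul]
    have : 2 ^ m₁ • ((1, 0) : ZMod (2 ^ m₁) × ZMod (2 ^ (m₂ + 1))) = 0 := by simp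
    rw [this, ofAdd_zero, mul_one, mul_comm]

/-- This map is the model of G → G/G': in a commutative image the commutator x^(2^m₁) must die, so
the order of x drops to 2^m₁ while that of y stays 2^(m₂+1). -/
theorem exists_monoidHom_zmod :
    ∃ f : G →* Multiplicative (ZMod (2 ^ m₁) × ZMod (2 ^ (m₂ + 1))),
      Function.Surjective f ∧ ∀ g, g ∈ f.ker ↔ g = 1 ∨ g = x ^ 2 ^ m₁ := by
  obtain ⟨f, hx, hy⟩ := h.exists_monoidHom (isD4Pair_zmod (m₁ := m₁) (m₂ := m₂))
  have hf : ∀ i j : ℕ, f (x ^ i * y ^ j) = Multiplicative.ofAdd ((i : ZMod (2 ^ m₁)),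
      (j : ZMod (2 ^ (m₂ + 1)))) := by
    intro i j
    rw [map_mul, map_pow, map_pow, hx, hy, ← ofAdd_nsmul, ← ofAdd_nsmul, ← ofAdd_add]
    simp
  refine ⟨f, fun p => ?_, fun g => ⟨fun hg => ?_, ?_⟩⟩
  · refine ⟨x ^ (p.toAdd.1.val) * y ^ (p.toAdd.2.val), ?_⟩
    rw [hf]
    simp
  · obtain ⟨i, j, rfl⟩ := h.exists_eq_pow_mul_pow g
    rw [MonoidHom.mem_ker, hf, ofAdd_eq_one, Prod.mk_eq_zero, ZMod.natCast_eq_zero_iff,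
      ZMod.natCast_eq_zero_iff] at hg
    obtain ⟨⟨i, rfl⟩, ⟨j, rfl⟩⟩ := hg
    rw [pow_mul y, h.isD4Pair.pow_y, one_pow, mul_one, pow_mul]
    rcases Nat.even_or_odd' i with ⟨i, rfl | rfl⟩
    · left
      rw [pow_mul, sq, h.pow_two_pow_mul_self, one_pow]
    · right
      rw [pow_succ, pow_mul, sq, h.pow_two_pow_mul_self, one_pow, one_mul]
  · rintro (rfl | rfl)
    · exact one_mem _
    · rw [MonoidHom.mem_ker, ← mul_one (x ^ 2 ^ m₁), ← pow_zero y, hf, ofAdd_eq_one,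
        ZMod.natCast_self]
      simp

theorem mem_commutator_iff (g : G) : g ∈ commutator G ↔ g = 1 ∨ g = x ^ 2 ^ m₁ := by
  obtain ⟨f, -, hf⟩ := h.exists_monoidHom_zmod
  constructor
  · intro hg
    exact (hf g).1 (Abelianization.commutator_subset_ker f hg)
  · rintro (rfl | rfl)
    · exact one_mem _
    · rw [← h.isD4Pair.comm]
      have := Subgroup.commutator_mem_commutator (Subgroup.mem_top x⁻¹) (Subgroup.mem_top y⁻¹)
      simpa [commutatorElement_def, commutator_def] using this

theorem abelianization_mulEquiv : Nonempty
    (Abelianization G ≃* Multiplicative (ZMod (2 ^ m₁) × ZMod (2 ^ (m₂ + 1)))) := by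
  obtain ⟨f, hf, hker⟩ := h.exists_monoidHom_zmod
  have : commutator G = f.ker := by
    ext g
    rw [h.mem_commutator_iff, hker]
  exact ⟨(QuotientGroup.quotientMulEquivOfEq this).trans
    (QuotientGroup.quotientKerEquivOfSurjective f hf)⟩

theorem abelianization_of_eq_iff (g k : G) :
    Abelianization.of g = Abelianization.of k ↔ k = g ∨ k = g * x ^ 2 ^ m₁ := by
  change (QuotientGroup.mk g : G ⧸ commutator G) = QuotientGroup.mk k ↔ _
  rw [QuotientGroup.eq, h.mem_commutator_iff, inv_mul_eq_one, inv_mul_eq_iff_eq_mul, eq_comm]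

end

end IsD4

instance Subgroup.center.commGroup (G : Type u) [Group G] : CommGroup (Subgroup.center G) where
  mul_comm a b := Subtype.ext (Subgroup.mem_center_iff.1 b.2 a)

theorem Abelianization.of_surjective (G : Type u) [Group G] :
    Function.Surjective (Abelianization.of (G := G)) :=
  QuotientGroup.mk_surjective

theorem QuaternionAlgebra.mk_neg_one {L : Type w} [CommRing L] (a b : L) :
    (⟨-1, 0, 0, 0⟩ : ℍ[L, a, b]) = -1 := by
  ext <;> simp

/-! ### Interpolation by (1 ± e)/2 -/

section HalfSum

variable {K : Type v} [Field K] [NeZero (2 : K)] {A : Type u} {B : Type w} [Ring A] [Ring B]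
  [Algebra K A] [Algebra K B] (f : A →ₐ[K] B) {e a b : A}

theorem map_half_smul_of_eq_one (he : f e = 1) :
    f ((2⁻¹ : K) • ((1 + e) * a + (1 - e) * b)) = f a := by
  rw [map_smul, map_add, map_mul, map_mul, map_add, map_sub, map_one, he, sub_self, zero_mul,
    add_zero, one_add_one_eq_two, two_mul, ← two_smul K, smul_smul, inv_mul_cancel₀ (NeZero.ne 2),
    one_smul]

theorem map_half_smul_of_eq_neg_one (he : f e = -1) :
    f ((2⁻¹ : K) • ((1 + e) * a + (1 - e) * b)) = f b := by
  rw [map_smul, map_add, map_mul, map_mul, map_add, map_sub, map_one, he, add_neg_cancel, zero_mul,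
    zero_add, sub_neg_eq_add, one_add_one_eq_two, two_mul, ← two_smul K, smul_smul,
    inv_mul_cancel₀ (NeZero.ne 2), one_smul]

end HalfSum

/-! ### Decomposition of the group algebra -/

namespace IsD4

variable {m₁ m₂ : ℕ} {G : Type u} [Group G] {x y : G} (h : IsD4 m₁ m₂ x y)
  (K : Type v) [Field K]

/-- The generator of the commutator subgroup, as an element of the centre. -/
def centralInvolution (h : IsD4 m₁ m₂ x y) : Subgroup.center G :=
  ⟨x ^ 2 ^ m₁, h.pow_mem_center⟩

/-- The maximal ideals of the group algebra of the centre at which the commutator is `-1`. -/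
abbrev MinusSpectrum : Type (max u v) :=
  {m : MaximalSpectrum (MonoidAlgebra K (Subgroup.center G)) //
    MonoidAlgebra.single h.centralInvolution (1 : K) + 1 ∈ m.asIdeal}

/-- The inclusion of the group algebra of the centre. -/
noncomputable def centerIncl (G : Type u) [Group G] :
    MonoidAlgebra K (Subgroup.center G) →ₐ[K] MonoidAlgebra K G :=
  MonoidAlgebra.mapDomainAlgHom K K (Subgroup.center G).subtype

@[simp]
theorem centerIncl_single (z : Subgroup.center G) (c : K) :
    centerIncl K G (MonoidAlgebra.single z c) = MonoidAlgebra.single (z : G) c := by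
  simp [centerIncl]

include h

theorem exists_eq_centerIncl (w : MonoidAlgebra K G) :
    ∃ r₀ r₁ r₂ r₃ : MonoidAlgebra K (Subgroup.center G),
      w = centerIncl K G r₀ + centerIncl K G r₁ * MonoidAlgebra.single x 1 +
        centerIncl K G r₂ * MonoidAlgebra.single y 1 +
        centerIncl K G r₃ * MonoidAlgebra.single (x * y) 1 := by
  induction w using MonoidAlgebra.induction_linear with
  | zero => exact ⟨0, 0, 0, 0, by simp⟩
  | add w w' hw hw' =>
    obtain ⟨r₀, r₁, r₂, r₃, rfl⟩ := hw
    obtain ⟨r₀', r₁', r₂', r₃', rfl⟩ := hw'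
    exact ⟨r₀ + r₀', r₁ + r₁', r₂ + r₂', r₃ + r₃', by simp only [map_add, add_mul]; abel⟩
  | single g c =>
    obtain ⟨z, hz, rfl | rfl | rfl | rfl⟩ := h.exists_center_mul g
    · exact ⟨.single ⟨g, hz⟩ c, 0, 0, 0, by simp⟩
    · exact ⟨0, .single ⟨z, hz⟩ c, 0, 0, by simp⟩
    · exact ⟨0, 0, .single ⟨z, hz⟩ c, 0, by simp⟩
    · exact ⟨0, 0, 0, .single ⟨z, hz⟩ c, by simp⟩

/-- Multiplication by 1 + s forgets the choice of lift along G → G/G'. Hence (1 + s)w vanishes as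
soon as w dies in K[G/G']. -/
theorem mul_mapDomain_surjInv (w : MonoidAlgebra K G) :
    (1 + MonoidAlgebra.single (x ^ 2 ^ m₁) 1) *
      MonoidAlgebra.mapDomain (Function.surjInv (Abelianization.of_surjective G))
        (MonoidAlgebra.mapDomainAlgHom K K Abelianization.of w) =
      (1 + MonoidAlgebra.single (x ^ 2 ^ m₁) 1) * w := by
  induction w using MonoidAlgebra.induction_linear with
  | zero => simp
  | add w w' hw hw' => rw [map_add, MonoidAlgebra.mapDomain_add, mul_add, hw, hw', mul_add]
  | single g c =>
    have hg := (Function.surjInv_eq (Abelianization.of_surjective G) (Abelianization.of g)).symm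
    have hs := (h.commute_pow g).eq
    rcases (h.abelianization_of_eq_iff _ _).1 hg with h1 | h1
    · simp [h1]
    · simp only [MonoidAlgebra.mapDomainAlgHom_apply, MonoidAlgebra.mapDomain_single,
        h1, add_mul, one_mul, MonoidAlgebra.single_mul_single, ← hs,
        ← mul_assoc, h.pow_two_pow_mul_self]
      rw [add_comm]

/-- Sending x and y to i and j forces x² and y² to become the scalars a and b; the hypothesis s ↦ -1
is exactly what makes the group relations hold. The coordinate formula reduces injectivity and
surjectivity to questions about K[Z(G)]. -/
theorem exists_algHom_quaternion {L : Type w} [CommRing L] [Algebra K L]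
    (χ : MonoidAlgebra K (Subgroup.center G) →ₐ[K] L)
    (hχ : χ (MonoidAlgebra.single h.centralInvolution (1 : K) + 1) = 0) :
    ∃ F : MonoidAlgebra K G →ₐ[K] ℍ[L, χ (.single ⟨x ^ 2, h.sq_x_mem_center⟩ 1),
        χ (.single ⟨y ^ 2, h.sq_y_mem_center⟩ 1)],
      ∀ r₀ r₁ r₂ r₃, F (centerIncl K G r₀ + centerIncl K G r₁ * MonoidAlgebra.single x 1 +
        centerIncl K G r₂ * MonoidAlgebra.single y 1 +
        centerIncl K G r₃ * MonoidAlgebra.single (x * y) 1) = ⟨χ r₀, χ r₁, χ r₂, χ r₃⟩ := by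
  set X : Subgroup.center G := ⟨x ^ 2, h.sq_x_mem_center⟩ with hX
  set Y : Subgroup.center G := ⟨y ^ 2, h.sq_y_mem_center⟩ with hY
  set a := χ (.single X 1) with ha
  set b := χ (.single Y 1) with hb
  have ha' : a ^ 2 ^ (m₁ - 1) = -1 := by
    have : X ^ 2 ^ (m₁ - 1) = h.centralInvolution := by
      ext
      simp only [hX, centralInvolution, Subgroup.coe_pow]
      rw [← pow_mul, ← pow_succ', Nat.sub_add_cancel h.one_le]
    rw [ha, ← map_pow, MonoidAlgebra.single_pow, this, one_pow]
    rw [map_add, map_one] at hχ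
    exact eq_neg_of_add_eq_zero_left hχ
  have hb' : b ^ 2 ^ m₂ = 1 := by
    have : Y ^ 2 ^ m₂ = 1 := by
      ext
      simp only [hY, Subgroup.coe_pow, Subgroup.coe_one]
      rw [← pow_mul, ← pow_succ', h.isD4Pair.pow_y]
    rw [hb, ← map_pow, MonoidAlgebra.single_pow, this, one_pow, ← MonoidAlgebra.one_def, map_one]
  obtain ⟨f, hx, hy⟩ := h.exists_monoidHom_quaternion ha' hb'
  let F := MonoidAlgebra.lift K (ℍ[L, a, b]) G f
  have hF : F.comp (centerIncl K G) =
      (IsScalarTower.toAlgHom K L (ℍ[L, a, b])).comp χ := by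
    apply MonoidAlgebra.algHom_ext
    · rintro ⟨z, hz⟩
      obtain ⟨i, j, hij⟩ := (h.mem_center_iff z).1 hz
      have hz' : (⟨z, hz⟩ : Subgroup.center G) = X ^ i * Y ^ j := Subtype.ext hij
      have h1 : (MonoidAlgebra.single (X ^ i * Y ^ j) 1 : MonoidAlgebra K (Subgroup.center G)) =
          .single X 1 ^ i * .single Y 1 ^ j := by
        simp [MonoidAlgebra.single_pow, MonoidAlgebra.single_mul_single]
      have hX' : f X = algebraMap L _ a := by rw [hX, map_pow, hx, QuaternionAlgebra.genI_sq]
      have hY' : f Y = algebraMap L _ b := by rw [hY, map_pow, hy, QuaternionAlgebra.genJ_sq]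
      rw [AlgHom.comp_apply, AlgHom.comp_apply, centerIncl_single, hz', h1, map_mul, map_pow,
        map_pow]
      simp [F, hX', hY', ← ha, ← hb]
    · exact Subsingleton.elim _ _
  have hF' : ∀ r, F (centerIncl K G r) = algebraMap L _ (χ r) := fun r => DFunLike.congr_fun hF r
  refine ⟨F, fun r₀ r₁ r₂ r₃ => ?_⟩
  have hFs : ∀ g, F (.single g 1) = f g := fun g => by simp [F]
  simp only [map_add, map_mul, hF', hFs, hx, hy]
  ext <;> simp [QuaternionAlgebra.genI, QuaternionAlgebra.genJ, QuaternionAlgebra.algebraMap_eq]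

/-- For injectivity, vanishing in K[G/G'] gives (1 + s)w = 0 and vanishing in the quaternion factors
gives (1 - s)w = 0, so 2w = 0. For surjectivity, preimages for the two halves are glued by (1 ±
s)/2. -/
theorem exists_algEquiv [NeZero (2 : K)] [NeZero (Nat.card (Subgroup.center G) : K)] :
    ∃ a b : ∀ m : h.MinusSpectrum K, MonoidAlgebra K (Subgroup.center G) ⧸ m.1.asIdeal,
      (∀ m, a m ≠ 0 ∧ b m ≠ 0) ∧
      Nonempty (MonoidAlgebra K G ≃ₐ[K] MonoidAlgebra K (Abelianization G) ×
        ∀ m : h.MinusSpectrum K,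
          ℍ[MonoidAlgebra K (Subgroup.center G) ⧸ m.1.asIdeal, a m, b m]) := by
  have := h.finite
  set R := MonoidAlgebra K (Subgroup.center G)
  set s := h.centralInvolution
  have hss : s * s = 1 := Subtype.ext h.pow_two_pow_mul_self
  choose F hF using fun m : h.MinusSpectrum K =>
    h.exists_algHom_quaternion K (Ideal.Quotient.mkₐ K m.1.asIdeal)
      (Ideal.Quotient.eq_zero_iff_mem.2 m.2)
  have hunit : ∀ (m : h.MinusSpectrum K) (z : Subgroup.center G),
      Ideal.Quotient.mkₐ K m.1.asIdeal (.single z 1) ≠ 0 := by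
    intro m z hz
    have := m.1.isMaximal
    have h1 := congrArg (· * Ideal.Quotient.mkₐ K m.1.asIdeal (.single z⁻¹ 1)) hz
    simp only [← map_mul, MonoidAlgebra.single_mul_single, mul_inv_cancel, mul_one, zero_mul] at h1
    rw [← MonoidAlgebra.one_def, map_one] at h1
    exact one_ne_zero h1
  refine ⟨_, _, fun m => ⟨hunit m _, hunit m _⟩,
    ⟨AlgEquiv.ofBijective ((MonoidAlgebra.mapDomainAlgHom K K Abelianization.of).prod
      (AlgHom.pi F)) ⟨?_, ?_⟩⟩⟩
  · rw [injective_iff_map_eq_zero]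
    intro w hw
    have h1 : MonoidAlgebra.mapDomainAlgHom K K Abelianization.of w = 0 := congrArg Prod.fst hw
    have h2 : ∀ m, F m w = 0 := fun m => congrFun (congrArg Prod.snd hw) m
    have h3 := h.mul_mapDomain_surjInv K w
    rw [h1, MonoidAlgebra.mapDomain_zero, mul_zero] at h3
    obtain ⟨r₀, r₁, r₂, r₃, hr⟩ := h.exists_eq_centerIncl K w
    -- K[Z(G)] is the product of its residue fields, and (1 + s)(1 - s) = 0. At a maximal ideal
    -- containing 1 + s the residue of r is zero; at any other one 1 - s is zero.
    have key : ∀ r : R, (∀ m : h.MinusSpectrum K, Ideal.Quotient.mkₐ K m.1.asIdeal r = 0) →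
        (1 - .single s 1) * r = 0 := by
      intro r hr
      apply (IsArtinianRing.equivPi R).injective
      ext m
      rw [map_zero, IsArtinianRing.equivPi_apply, Pi.zero_apply]
      have hp : (.single s 1 + 1) * (1 - .single s 1 : R) ∈ m.asIdeal := by
        have : (.single s 1 + 1) * (1 - .single s 1 : R) = 0 := by
          have : (.single s 1 * .single s 1 : R) = 1 := by
            rw [MonoidAlgebra.single_mul_single, hss, one_mul, MonoidAlgebra.one_def]
          linear_combination -this
        rw [this]; exact zero_mem _
      rcases m.isMaximal.isPrime.mem_or_mem hp with hm | hm
      · exact Ideal.Quotient.eq_zero_iff_mem.2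
          (Ideal.mul_mem_left _ _ (Ideal.Quotient.eq_zero_iff_mem.1 (hr ⟨m, hm⟩)))
      · exact Ideal.Quotient.eq_zero_iff_mem.2 (Ideal.mul_mem_right _ _ hm)
    have h4 : (1 - .single (x ^ 2 ^ m₁) 1 : MonoidAlgebra K G) * w = 0 := by
      have hs : (1 - .single (x ^ 2 ^ m₁) 1 : MonoidAlgebra K G) =
          centerIncl K G (1 - .single s 1) := by
        rw [map_sub, map_one, centerIncl_single]; rfl
      have h5 := fun m => (hF m r₀ r₁ r₂ r₃).symm.trans (hr ▸ h2 m)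
      rw [hr, hs, mul_add, mul_add, mul_add, ← mul_assoc, ← mul_assoc, ← mul_assoc, ← map_mul,
        ← map_mul, ← map_mul, ← map_mul,
        key r₀ fun m => congrArg QuaternionAlgebra.re (h5 m),
        key r₁ fun m => congrArg QuaternionAlgebra.imI (h5 m),
        key r₂ fun m => congrArg QuaternionAlgebra.imJ (h5 m),
        key r₃ fun m => congrArg QuaternionAlgebra.imK (h5 m)]
      simp
    have h6 : (2 : K) • w = 0 := by
      rw [two_smul]
      calc w + w = (1 + .single (x ^ 2 ^ m₁) 1) * w + (1 - .single (x ^ 2 ^ m₁) 1) * w := by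
            noncomm_ring
        _ = 0 := by rw [← h3, h4, add_zero]
    exact (smul_eq_zero.1 h6).resolve_left (NeZero.ne 2)
  · rintro ⟨u, v⟩
    obtain ⟨a, ha⟩ : ∃ a, MonoidAlgebra.mapDomainAlgHom K K (Abelianization.of (G := G)) a = u := by
      induction u using MonoidAlgebra.induction_linear with
      | zero => exact ⟨0, map_zero _⟩
      | add u u' hu hu' =>
        obtain ⟨a, rfl⟩ := hu
        obtain ⟨a', rfl⟩ := hu'
        exact ⟨a + a', map_add _ _ _⟩
      | single g c =>
        obtain ⟨g, rfl⟩ := Abelianization.of_surjective G g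
        exact ⟨.single g c, by simp⟩
    have hR : ∀ v : ∀ m : h.MinusSpectrum K, R ⧸ m.1.asIdeal,
        ∃ r : R, ∀ m : h.MinusSpectrum K, Ideal.Quotient.mkₐ K m.1.asIdeal r = v m := by
      classical
      intro v
      -- Chinese remainder theorem; the prescribed residue 0 outside the minus part is arbitrary.
      obtain ⟨r, hr⟩ := (IsArtinianRing.equivPi R).surjective
        fun m => if hm : MonoidAlgebra.single s (1 : K) + 1 ∈ m.asIdeal then v ⟨m, hm⟩ else 0
      refine ⟨r, fun m => ?_⟩
      have := congrFun hr m.1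
      rw [dif_pos m.2] at this
      exact this
    obtain ⟨r₀, h₀⟩ := hR fun m => (v m).re
    obtain ⟨r₁, h₁⟩ := hR fun m => (v m).imI
    obtain ⟨r₂, h₂⟩ := hR fun m => (v m).imJ
    obtain ⟨r₃, h₃⟩ := hR fun m => (v m).imK
    set b : MonoidAlgebra K G := centerIncl K G r₀ + centerIncl K G r₁ * MonoidAlgebra.single x 1 +
        centerIncl K G r₂ * MonoidAlgebra.single y 1 +
        centerIncl K G r₃ * MonoidAlgebra.single (x * y) 1
    have hFb : ∀ m, F m b = v m := by
      intro m
      rw [hF, h₀, h₁, h₂, h₃]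
    have hFs : ∀ m, F m (.single (x ^ 2 ^ m₁) 1) = -1 := by
      intro m
      have h1 := hF m (.single s 1) 0 0 0
      have h2 : Ideal.Quotient.mkₐ K m.1.asIdeal (.single s 1) = -1 := by
        have := Ideal.Quotient.eq_zero_iff_mem.2 m.2
        rw [map_add, map_one] at this
        exact eq_neg_of_add_eq_zero_left this
      simp only [map_zero, zero_mul, add_zero, centerIncl_single, h2] at h1
      exact h1.trans (QuaternionAlgebra.mk_neg_one _ _)
    have hπs : MonoidAlgebra.mapDomainAlgHom K K Abelianization.of
        (.single (x ^ 2 ^ m₁) 1 : MonoidAlgebra K G) = 1 := by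
      have : (Abelianization.of (x ^ 2 ^ m₁) : Abelianization G) = 1 := by
        rw [← map_one Abelianization.of, h.abelianization_of_eq_iff]
        right
        exact h.pow_two_pow_mul_self.symm
      simp [this, MonoidAlgebra.one_def]
    refine ⟨(2⁻¹ : K) • ((1 + .single (x ^ 2 ^ m₁) 1) * a + (1 - .single (x ^ 2 ^ m₁) 1) * b), ?_⟩
    refine Prod.ext ?_ (funext fun m => ?_)
    · change MonoidAlgebra.mapDomainAlgHom K K Abelianization.of _ = u
      exact (map_half_smul_of_eq_one _ hπs).trans ha
    · change F m _ = v m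
      exact (map_half_smul_of_eq_neg_one _ (hFs m)).trans (hFb m)

end IsD4

/-! ### Counting simple components -/

section SimpleComponents

theorem numSimpleComponents_congr {A : Type u} {B : Type v} [Ring A] [Ring B] (e : A ≃+* B) :
    numSimpleComponents A = numSimpleComponents B :=
  Nat.card_congr (e.mapTwoSidedIdeal.toEquiv.subtypeEquiv fun I =>
    (OrderIso.isAtom_iff e.mapTwoSidedIdeal I).symm)

/-- The two-sided ideal generated by a central idempotent. -/
def TwoSidedIdeal.ofCentral {A : Type u} [Ring A] (e : A) (he : ∀ w, Commute e w) :
    TwoSidedIdeal A :=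
  TwoSidedIdeal.mk' {w | e * w = w} (mul_zero e)
    (fun {a b} (ha : e * a = a) (hb : e * b = b) => by simp [mul_add, ha, hb])
    (fun {a} (ha : e * a = a) => by simp [ha])
    (fun {a b} (hb : e * b = b) => by
      rw [Set.mem_ofPred_eq, ← mul_assoc, (he a).eq, mul_assoc, hb])
    (fun {a b} (ha : e * a = a) => by rw [Set.mem_ofPred_eq, ← mul_assoc, ha])

theorem TwoSidedIdeal.mem_ofCentral {A : Type u} [Ring A] (e : A) (he : ∀ w, Commute e w) (w : A) :
    w ∈ TwoSidedIdeal.ofCentral e he ↔ e * w = w :=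
  TwoSidedIdeal.mem_mk' ..

/-- A nonzero ideal contains some w with e i * w ≠ 0, since the idempotents sum to 1, and then
contains e i. So the ideals cut out by the e i are exactly the minimal ones. -/
theorem numSimpleComponents_eq_card {A : Type u} [Ring A] {ι : Type v} [Fintype ι] (e : ι → A)
    (hcomm : ∀ i w, Commute (e i) w) (hidem : ∀ i, e i * e i = e i)
    (horth : ∀ i j, i ≠ j → e i * e j = 0) (hsum : ∑ i, e i = 1) (hne : ∀ i, e i ≠ 0)
    (hsimple : ∀ i (I : TwoSidedIdeal A) w, w ∈ I → e i * w ≠ 0 → e i ∈ I) :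
    numSimpleComponents A = Fintype.card ι := by
  let I : ι → TwoSidedIdeal A := fun i => .ofCentral (e i) (hcomm i)
  have hI : ∀ i w, w ∈ I i ↔ e i * w = w := fun i w => TwoSidedIdeal.mem_ofCentral _ _ w
  have hle : ∀ i (J : TwoSidedIdeal A), e i ∈ J → I i ≤ J := by
    intro i J hJ w hw
    rw [← (hI i w).1 hw]
    exact J.mul_mem_right _ _ hJ
  have hbot : ∀ i, I i ≠ ⊥ := by
    intro i hi
    have : e i ∈ I i := (hI i _).2 (hidem i)
    rw [hi, TwoSidedIdeal.mem_bot] at this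
    exact hne i this
  have hex : ∀ J : TwoSidedIdeal A, J ≠ ⊥ → ∃ w ∈ J, w ≠ 0 := by
    intro J hJ
    by_contra! h
    exact hJ (le_antisymm (fun w hw => TwoSidedIdeal.mem_bot _ |>.2 (h w hw)) bot_le)
  have hatom : ∀ i, IsAtom (I i) := by
    intro i
    refine ⟨hbot i, fun J hJ => ?_⟩
    by_contra hJ0
    obtain ⟨w, hw, hw0⟩ := hex J hJ0
    refine hJ.not_ge (hle i J (hsimple i J w hw ?_))
    rwa [(hI i w).1 (hJ.le hw)]
  rw [numSimpleComponents, ← Nat.card_eq_fintype_card]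
  symm
  refine Nat.card_congr (Equiv.ofBijective (fun i => ⟨I i, hatom i⟩) ⟨fun i j hij => ?_, ?_⟩)
  · by_contra hne'
    have h1 : e i ∈ I j := by
      have hij' : I i = I j := congrArg Subtype.val hij
      rw [← hij']
      exact (hI i _).2 (hidem i)
    rw [hI, horth j i (Ne.symm hne')] at h1
    exact hne i h1.symm
  · rintro ⟨J, hJ⟩
    obtain ⟨w, hw, hw0⟩ := hex J hJ.1
    obtain ⟨i, hi⟩ : ∃ i, e i * w ≠ 0 := by
      by_contra! h
      apply hw0
      rw [← one_mul w, ← hsum, Finset.sum_mul]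
      exact Finset.sum_eq_zero fun i _ => h i
    exact ⟨i, Subtype.ext ((hJ.le_iff_eq (hbot i)).1 (hle i J (hsimple i J w hw hi)))⟩

/-- The preimage of I is an ideal of S. The map need not be unital, so that inclusions of factors
into a product are covered. -/
theorem IsSimpleRing.map_one_mem {S : Type u} {A : Type v} [Ring S] [Ring A] [IsSimpleRing S]
    (f : S →ₙ+* A) (I : TwoSidedIdeal A) {s : S} (hs : s ≠ 0) (h : f s ∈ I) : f 1 ∈ I := by
  let J : TwoSidedIdeal S := TwoSidedIdeal.mk' {t | f t ∈ I}
    (by simp [I.zero_mem])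
    (fun {a b} ha hb => by simpa using I.add_mem ha hb)
    (fun {a} ha => by simpa using I.neg_mem ha)
    (fun {a b} hb => by simpa using I.mul_mem_left _ _ hb)
    (fun {a b} ha => by simpa using I.mul_mem_right _ _ ha)
  have hJ : ∀ t, t ∈ J ↔ f t ∈ I := fun t => TwoSidedIdeal.mem_mk' ..
  exact (hJ 1).1 (IsSimpleRing.one_mem_of_ne_zero_mem J hs ((hJ s).2 h))

theorem QuaternionAlgebra.isSimpleRing {L : Type w} [Field L] (h2 : (2 : L) ≠ 0) {a b : L}
    (ha : a ≠ 0) (hb : b ≠ 0) : IsSimpleRing (ℍ[L, a, b]) := by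
  refine IsSimpleRing.of_eq_bot_or_eq_top fun I => or_iff_not_imp_left.2 fun hI => ?_
  rw [← I.one_mem_iff]
  have hscalar : ∀ c : L, c ≠ 0 → algebraMap L (ℍ[L, a, b]) c ∈ I → 1 ∈ I := by
    intro c hc hcI
    have := I.mul_mem_left (algebraMap L _ c⁻¹) _ hcI
    rwa [← map_mul, inv_mul_cancel₀ hc, map_one] at this
  have hre : ∀ w ∈ I, w.re ≠ 0 → 1 ∈ I := by
    intro w hw hw0
    -- The map w ↦ a w + i w i doubles and scales by a the coordinates at 1 and i and kills those at
    -- j and k; the analogue for j then leaves 4ab times the real part.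
    refine hscalar (2 * 2 * a * b * w.re) (by positivity) ?_
    have hmem : ∀ w ∈ I, ∀ g : ℍ[L, a, b], ∀ c : L, algebraMap L _ c * w + g * w * g ∈ I :=
      fun w hw g c => I.add_mem (I.mul_mem_left _ _ hw) (I.mul_mem_right _ _ (I.mul_mem_left _ _ hw))
    have := hmem _ (hmem w hw (genI a b) a) (genJ a b) b
    convert this using 1
    ext <;> simp [genI, genJ, algebraMap_eq] <;> ring
  obtain ⟨w, hw, hw0⟩ : ∃ w ∈ I, w ≠ 0 := by
    by_contra! h
    exact hI (le_antisymm (fun w hw => TwoSidedIdeal.mem_bot _ |>.2 (h w hw)) bot_le)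
  by_contra h1
  have h0 : ∀ w ∈ I, w.re = 0 := fun w hw => by
    by_contra h
    exact h1 (hre w hw h)
  -- Multiplication by i, j or k moves each imaginary coordinate, up to a nonzero factor, into the
  -- real part.
  apply hw0
  ext
  · exact h0 w hw
  · simpa [ha] using h0 _ (I.mul_mem_right w ⟨0, 1, 0, 0⟩ hw)
  · simpa [hb] using h0 _ (I.mul_mem_right w ⟨0, 0, 1, 0⟩ hw)
  · simpa [ha, hb] using h0 _ (I.mul_mem_right w ⟨0, 0, 0, 1⟩ hw)

theorem numSimpleComponents_pi_prod_pi {f q : ℕ} (F : Fin f → Type u) (H : Fin q → Type v)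
    [∀ i, Ring (F i)] [∀ j, Ring (H j)] [∀ i, IsSimpleRing (F i)] [∀ j, IsSimpleRing (H j)] :
    numSimpleComponents ((∀ i, F i) × (∀ j, H j)) = f + q := by
  obtain ⟨fF, hfF⟩ : ∃ fF : ∀ i, F i →ₙ+* (∀ i, F i) × (∀ j, H j),
      ∀ i s, fF i s = (Pi.single i s, 0) := ⟨fun i =>
    { toFun := fun s => (Pi.single i s, 0)
      map_zero' := by simp
      map_add' := fun s t => by simp [Pi.single_add]
      map_mul' := fun s t => by simp [Pi.single_mul] }, fun _ _ => rfl⟩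
  obtain ⟨fH, hfH⟩ : ∃ fH : ∀ j, H j →ₙ+* (∀ i, F i) × (∀ j, H j),
      ∀ j s, fH j s = (0, Pi.single j s) := ⟨fun j =>
    { toFun := fun s => (0, Pi.single j s)
      map_zero' := by simp
      map_add' := fun s t => by simp [Pi.single_add]
      map_mul' := fun s t => by simp [Pi.single_mul] }, fun _ _ => rfl⟩
  let e : Fin f ⊕ Fin q → (∀ i, F i) × (∀ j, H j) := Sum.elim (fun i => fF i 1) (fun j => fH j 1)
  have hF : ∀ i (w : (∀ i, F i) × (∀ j, H j)), fF i 1 * w = fF i (w.1 i) := fun i w => by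
    rw [hfF, hfF]
    refine Prod.ext ?_ (zero_mul _)
    exact (Pi.single_mul_left 1).symm.trans (by rw [one_mul])
  have hF' : ∀ i (w : (∀ i, F i) × (∀ j, H j)), w * fF i 1 = fF i (w.1 i) := fun i w => by
    rw [hfF, hfF]
    refine Prod.ext ?_ (mul_zero _)
    exact (Pi.single_mul_right 1).symm.trans (by rw [mul_one])
  have hH : ∀ j (w : (∀ i, F i) × (∀ j, H j)), fH j 1 * w = fH j (w.2 j) := fun j w => by
    rw [hfH, hfH]
    refine Prod.ext (zero_mul _) ?_
    exact (Pi.single_mul_left 1).symm.trans (by rw [one_mul])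
  have hH' : ∀ j (w : (∀ i, F i) × (∀ j, H j)), w * fH j 1 = fH j (w.2 j) := fun j w => by
    rw [hfH, hfH]
    refine Prod.ext (mul_zero _) ?_
    exact (Pi.single_mul_right 1).symm.trans (by rw [mul_one])
  rw [numSimpleComponents_eq_card e]
  · simp
  · rintro (i | j) w
    · exact (hF i w).trans (hF' i w).symm
    · exact (hH j w).trans (hH' j w).symm
  · rintro (i | j)
    · exact (hF i _).trans (by simp [e, hfF])
    · exact (hH j _).trans (by simp [e, hfH])
  · rintro (i | i) (j | j) hij
    · exact (hF i _).trans (by simp [e, hfF, Pi.single_eq_of_ne (show i ≠ j by simpa using hij)])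
    · exact (hF i _).trans (by simp [e, hfF, hfH])
    · exact (hH i _).trans (by simp [e, hfF, hfH])
    · exact (hH i _).trans (by simp [e, hfH, Pi.single_eq_of_ne (show i ≠ j by simpa using hij)])
  · rw [Fintype.sum_sum_type]
    refine Prod.ext ?_ ?_
    · simp only [e, Sum.elim_inl, Sum.elim_inr, Prod.fst_add, Prod.fst_sum, hfF, hfH,
        Finset.sum_const_zero, add_zero]
      exact Finset.univ_sum_single (1 : ∀ i, F i)
    · simp only [e, Sum.elim_inl, Sum.elim_inr, Prod.snd_add, Prod.snd_sum, hfF, hfH,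
        Finset.sum_const_zero, zero_add]
      exact Finset.univ_sum_single (1 : ∀ j, H j)
  · rintro (i | j) h0
    · have := congrFun (congrArg Prod.fst h0) i
      simp [e, hfF] at this
    · have := congrFun (congrArg Prod.snd h0) j
      simp [e, hfH] at this
  · rintro (i | j) I w hw h0
    · have h1 : fF i (w.1 i) ∈ I := hF i w ▸ I.mul_mem_left _ _ hw
      refine IsSimpleRing.map_one_mem (fF i) I (fun h => h0 ?_) h1
      exact (hF i w).trans (by rw [h, map_zero])
    · have h1 : fH j (w.2 j) ∈ I := hH j w ▸ I.mul_mem_left _ _ hw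
      refine IsSimpleRing.map_one_mem (fH j) I (fun h => h0 ?_) h1
      exact (hH j w).trans (by rw [h, map_zero])

theorem IsSumOfFieldsAndQuaternions.numSimpleComponents_eq {K : Type v} [Field K] [NeZero (2 : K)]
    {A : Type w} [Ring A] [Algebra K A] {f q : ℕ} (h : IsSumOfFieldsAndQuaternions K A f q) :
    numSimpleComponents A = f + q := by
  obtain ⟨F, _, _, L, _, _, a, b, hab, ⟨e⟩⟩ := h
  have : ∀ j, IsSimpleRing (ℍ[L j, a j, b j]) := fun j => by
    refine QuaternionAlgebra.isSimpleRing ?_ (hab j).1 (hab j).2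
    intro h2
    exact NeZero.ne (2 : K) ((map_eq_zero (algebraMap K (L j))).1 (by rw [map_ofNat, h2]))
  rw [numSimpleComponents_congr e.toRingEquiv]
  exact numSimpleComponents_pi_prod_pi _ _

end SimpleComponents

theorem IsD4.isSumOfFieldsAndQuaternions {m₁ m₂ : ℕ} {G : Type u} [Group G] {x y : G}
    (h : IsD4 m₁ m₂ x y) (K : Type v) [Field K] [NeZero (2 : K)]
    [NeZero (Nat.card (Subgroup.center G) : K)] [NeZero (Nat.card (Abelianization G) : K)] :
    IsSumOfFieldsAndQuaternions K (MonoidAlgebra K G)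
      (Nat.card (MaximalSpectrum (MonoidAlgebra K (Abelianization G))))
      (Nat.card (h.MinusSpectrum K)) := by
  have := h.finite
  have : Finite (Abelianization G) := Quotient.finite _
  obtain ⟨a, b, hab, ⟨E⟩⟩ := h.exists_algEquiv K
  let eF := (Finite.equivFin (MaximalSpectrum (MonoidAlgebra K (Abelianization G)))).symm
  let eL := (Finite.equivFin (h.MinusSpectrum K)).symm
  refine ⟨fun i => MonoidAlgebra K (Abelianization G) ⧸ (eF i).asIdeal,
    fun i => Ideal.Quotient.field _, fun i => inferInstance,
    fun j => MonoidAlgebra K (Subgroup.center G) ⧸ (eL j).1.asIdeal,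
    fun j => Ideal.Quotient.field _, fun j => inferInstance,
    fun j => a (eL j), fun j => b (eL j), fun j => hab (eL j), ⟨?_⟩⟩
  refine E.trans (AlgEquiv.prodCongr ?_ ?_)
  · exact ((IsArtinianRing.equivPi (MonoidAlgebra K (Abelianization G))).restrictScalars K).trans
      (AlgEquiv.piCongrLeft K (fun m : MaximalSpectrum (MonoidAlgebra K (Abelianization G)) =>
        MonoidAlgebra K (Abelianization G) ⧸ m.asIdeal) eF).symm
  · exact (AlgEquiv.piCongrLeft K (fun m : h.MinusSpectrum K =>
        ℍ[MonoidAlgebra K (Subgroup.center G) ⧸ m.1.asIdeal, a m, b m]) eL).symm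

/-! ### Counting cyclic subgroups -/

section CyclicSubgroups

variable {B : Type u} {C : Type v} [Group B] [Group C]

theorem numCyclicSubgroups_eq_ncard (B : Type u) [Group B] :
    numCyclicSubgroups B = (Subgroup.zpowers '' (Set.univ : Set B)).ncard := by
  rw [← Nat.card_coe_set_eq]
  refine Nat.card_congr (Equiv.subtypeEquivRight fun H => ?_)
  rw [Subgroup.isCyclic_iff_exists_zpowers_eq_top]
  simp

theorem zpowers_map_eq_iff {f : B →* C} (hf : Function.Injective f) (a b : B) :
    Subgroup.zpowers (f a) = Subgroup.zpowers (f b) ↔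
      Subgroup.zpowers a = Subgroup.zpowers b := by
  rw [← MonoidHom.map_zpowers, ← MonoidHom.map_zpowers]
  exact (Subgroup.map_injective hf).eq_iff

theorem ncard_image_zpowers_image [Finite B] {f : B →* C} (hf : Function.Injective f)
    (S : Set B) : (Subgroup.zpowers '' (f '' S)).ncard = (Subgroup.zpowers '' S).ncard := by
  rw [Set.image_image]
  exact Set.ncard_image_eq_of_iff fun a _ b _ => zpowers_map_eq_iff hf a b

theorem numCyclicSubgroups_congr [Finite B] (e : B ≃* C) :
    numCyclicSubgroups B = numCyclicSubgroups C := by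
  rw [numCyclicSubgroups_eq_ncard, numCyclicSubgroups_eq_ncard,
    ← ncard_image_zpowers_image (f := e.toMonoidHom) e.injective]
  congr 2
  exact Set.image_univ_of_surjective e.surjective

theorem zpowers_eq_iff_of_pow_four {b c : B} (hb : b ^ 4 = 1) :
    Subgroup.zpowers b = Subgroup.zpowers c ↔ c = b ∨ c = b ^ 3 := by
  have hb' : b ^ 2 ^ 2 = 1 := hb
  rw [zpowers_eq_zpowers_iff_of_pow_two_pow hb']
  constructor
  · rintro ⟨r, hr, rfl⟩
    have : r % 4 = 1 ∨ r % 4 = 3 := by have := Nat.odd_iff.1 hr; omega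
    rcases this with h | h
    · left
      conv_rhs => rw [← pow_one b]
      exact pow_eq_pow_of_modEq_two_pow hb' h
    · right
      exact pow_eq_pow_of_modEq_two_pow hb' h
  · rintro (rfl | rfl)
    · exact ⟨1, odd_one, (pow_one _).symm⟩
    · exact ⟨3, by decide, rfl⟩

/-- A cyclic subgroup of exponent dividing 4 is encoded by its generators {a, a³}, which makes the
count decidable: 1 + 3 + 6. -/
theorem ncard_image_zpowers_zmod_four :
    (Subgroup.zpowers '' (Set.univ : Set (Multiplicative (ZMod 4 × ZMod 4)))).ncard = 10 := by
  have h4 : ∀ b : Multiplicative (ZMod 4 × ZMod 4), b ^ 4 = 1 := by decide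
  have key : ∀ a b : Multiplicative (ZMod 4 × ZMod 4),
      (b = a ∨ b = a ^ 3) ↔ ({a, a ^ 3} : Finset _) = {b, b ^ 3} := by decide
  rw [Set.ncard_image_eq_of_iff (g := fun a => ({a, a ^ 3} : Finset _)) fun a _ b _ =>
    (zpowers_eq_iff_of_pow_four (h4 a)).trans (key a b)]
  have : (fun a : Multiplicative (ZMod 4 × ZMod 4) => ({a, a ^ 3} : Finset _)) '' Set.univ =
      ((Finset.univ.image fun a : Multiplicative (ZMod 4 × ZMod 4) =>
        ({a, a ^ 3} : Finset _) : Finset _) : Set _) := by simp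
  rw [this, Set.ncard_coe_finset]
  decide

/-- The homomorphism `ℤ/4 → ℤ/2ⁿ` that sends `1` to `2ⁿ⁻²`. -/
theorem exists_zmod_four_hom {n : ℕ} (hn : 2 ≤ n) :
    ∃ f : ZMod 4 →+ ZMod (2 ^ n), Function.Injective f ∧ ∀ b, 4 • b = 0 → b ∈ Set.range f := by
  obtain ⟨k, rfl⟩ := Nat.exists_eq_add_of_le' hn
  have hcast : ((4 * 2 ^ k : ℕ) : ZMod (2 ^ (k + 2))) = 0 := by
    rw [ZMod.natCast_eq_zero_iff, pow_add, mul_comm]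
    norm_num
  let f : ZMod 4 →+ ZMod (2 ^ (k + 2)) := ZMod.lift 4
    ⟨(AddMonoidHom.mulLeft ((2 ^ k : ℕ) : ZMod (2 ^ (k + 2)))).comp (Int.castAddHom _), by
      simpa [mul_comm] using hcast⟩
  have hf : ∀ i : ℕ, f (i : ZMod 4) = ((2 ^ k * i : ℕ) : ZMod (2 ^ (k + 2))) := by
    intro i
    have := ZMod.lift_coe 4 ⟨(AddMonoidHom.mulLeft ((2 ^ k : ℕ) : ZMod (2 ^ (k + 2)))).comp
      (Int.castAddHom _), by simpa [mul_comm] using hcast⟩ (i : ℤ)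
    simpa [f] using this
  refine ⟨f, ?_, fun b hb => ?_⟩
  · rw [injective_iff_map_eq_zero]
    intro a ha
    obtain ⟨i, rfl⟩ := ZMod.natCast_zmod_surjective a
    rw [hf, ZMod.natCast_eq_zero_iff, pow_add, Nat.mul_dvd_mul_iff_left (by positivity)] at ha
    rwa [ZMod.natCast_eq_zero_iff]
  · obtain ⟨i, rfl⟩ := ZMod.natCast_zmod_surjective b
    have : ((4 * i : ℕ) : ZMod (2 ^ (k + 2))) = 0 := by simpa using hb
    rw [ZMod.natCast_eq_zero_iff, pow_add, mul_comm] at this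
    obtain ⟨c, rfl⟩ := Nat.dvd_of_mul_dvd_mul_left (k := 4) (by norm_num) this
    exact ⟨(c : ZMod 4), hf c⟩

theorem ncard_image_zpowers_pow_four {n₁ n₂ : ℕ} (h₁ : 2 ≤ n₁) (h₂ : 2 ≤ n₂)
    (e : B ≃* Multiplicative (ZMod (2 ^ n₁) × ZMod (2 ^ n₂))) :
    (Subgroup.zpowers '' {b : B | b ^ 4 = 1}).ncard = 10 := by
  obtain ⟨f₁, hf₁, hf₁'⟩ := exists_zmod_four_hom h₁
  obtain ⟨f₂, hf₂, hf₂'⟩ := exists_zmod_four_hom h₂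
  let f : Multiplicative (ZMod 4 × ZMod 4) →* B :=
    e.symm.toMonoidHom.comp (AddMonoidHom.toMultiplicative (f₁.prodMap f₂))
  have hf : Function.Injective f := e.symm.injective.comp (hf₁.prodMap hf₂)
  rw [← ncard_image_zpowers_zmod_four, ← ncard_image_zpowers_image hf]
  congr 2
  ext b
  constructor
  · intro hb
    have hb' : 4 • (e b).toAdd = 0 := by
      rw [← toAdd_pow, ← map_pow, show b ^ 4 = 1 from hb, map_one, toAdd_one]
    obtain ⟨c₁, hc₁⟩ := hf₁' (e b).toAdd.1 (congrArg Prod.fst hb')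
    obtain ⟨c₂, hc₂⟩ := hf₂' (e b).toAdd.2 (congrArg Prod.snd hb')
    refine ⟨Multiplicative.ofAdd (c₁, c₂), trivial, ?_⟩
    change e.symm (Multiplicative.ofAdd (f₁ c₁, f₂ c₂)) = b
    rw [hc₁, hc₂]
    exact e.symm_apply_apply b
  · rintro ⟨c, -, rfl⟩
    have h4 : ∀ b : Multiplicative (ZMod 4 × ZMod 4), b ^ 4 = 1 := by decide
    change f c ^ 4 = 1
    rw [← map_pow, h4, map_one]

theorem pow_eq_one_of_zpowers_eq {b c : B} (h : Subgroup.zpowers b = Subgroup.zpowers c) {n : ℕ}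
    (hb : b ^ n = 1) : c ^ n = 1 := by
  obtain ⟨i, hi⟩ : c ∈ Subgroup.zpowers b := h ▸ Subgroup.mem_zpowers c
  rw [← hi]
  change (b ^ i) ^ n = 1
  rw [← zpow_natCast, zpow_comm, zpow_natCast, hb, one_zpow]

/-- If there are c cyclic subgroups, the ten of exponent dividing 4 count once and the others twice,
at least: 10 + 2(c - 10) = 2c - 10. -/
theorem card_powOrbit_of_ncard_eq_ten [Finite B] {k q : ℕ} (hq : Odd q)
    (hB : ∀ b : B, b ^ 2 ^ k = 1)
    (h10 : (Subgroup.zpowers '' {b : B | b ^ 4 = 1}).ncard = 10) :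
    10 ≤ numCyclicSubgroups B ∧
    2 * numCyclicSubgroups B - 10 ≤ (powOrbit q '' (Set.univ : Set B)).ncard ∧
    (q % 8 = 3 →
      (powOrbit q '' (Set.univ : Set B)).ncard = 2 * numCyclicSubgroups B - 10) := by
  have huniv : (Set.univ : Set B) = {b | b ^ 4 = 1} ∪ {b | b ^ 4 ≠ 1} := by
    ext b; simp [em]
  have hz : ∀ b ∈ {b : B | b ^ 4 = 1}, ∀ c ∈ {b : B | b ^ 4 ≠ 1},
      Subgroup.zpowers b ≠ Subgroup.zpowers c := fun b hb c hc h =>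
    hc (pow_eq_one_of_zpowers_eq h hb)
  have ho : ∀ b ∈ {b : B | b ^ 4 = 1}, ∀ c ∈ {b : B | b ^ 4 ≠ 1}, powOrbit q b ≠ powOrbit q c :=
    fun b hb c hc h => hz b hb c hc (zpowers_eq_of_powOrbit_eq hq (hB b) h)
  have hhigh := two_mul_ncard_image_zpowers hq hB {b | b ^ 4 ≠ 1} (fun b hb => hb)
    (fun b hb r hr h => hb (pow_eq_one_of_zpowers_eq
      ((zpowers_eq_zpowers_iff_of_pow_two_pow (hB b)).2 ⟨r, hr, rfl⟩).symm h))
  have hlow := ncard_image_zpowers_le_powOrbit hq hB {b : B | b ^ 4 = 1}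
  rw [h10] at hlow
  rw [numCyclicSubgroups_eq_ncard, huniv, Set.ncard_image_union_of_ne hz,
    Set.ncard_image_union_of_ne ho, h10]
  refine ⟨by omega, by omega, fun h3 => ?_⟩
  have hlow' := ncard_image_powOrbit_of_pow_four (q := q) (by omega) hB {b : B | b ^ 4 = 1}
    (fun b hb => hb)
  have := hhigh.2 h3
  omega

end CyclicSubgroups

/-! ### Characters that are -1 on a given involution -/

section

variable {K : Type v} [Field K] {A : Type u} {B : Type w} [CommGroup A] [CommGroup B] [Finite A]

theorem single_add_one_mem_charIdeal_iff (χ : A →* (AlgebraicClosure K)ˣ) (s : A) :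
    MonoidAlgebra.single s (1 : K) + 1 ∈ (charIdeal χ).asIdeal ↔
      (χ s : AlgebraicClosure K) = -1 := by
  rw [mem_charIdeal, map_add, map_one, charAlgHom_single, one_smul, eq_neg_iff_add_eq_zero]

/-- Characters of `A` that are trivial on the kernel of `p : A →* B` are characters of its range. -/
theorem ncard_image_zpowers_trivial_on_ker [NeZero (2 : K)] {k : ℕ} (hA : ∀ a : A, a ^ 2 ^ k = 1)
    (p : A →* B) :
    (Subgroup.zpowers '' {χ : A →* (AlgebraicClosure K)ˣ | p.ker ≤ χ.ker}).ncard =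
      numCyclicSubgroups p.range := by
  have hR : ∀ b : p.range, b ^ 2 ^ k = 1 := by
    rintro ⟨_, a, rfl⟩
    ext
    simp [← map_pow, hA]
  have : Finite p.range := Finite.of_surjective _ p.rangeRestrict_surjective
  obtain ⟨e⟩ := monoidHom_mulEquiv_of_two_group (K := K) hR
  have hs := p.rangeRestrict_surjective
  have hinj : Function.Injective (MonoidHom.compHom' (P := (AlgebraicClosure K)ˣ) p.rangeRestrict) := by
    intro χ ψ h
    exact (MonoidHom.cancel_right hs).1 h
  have : Finite (p.range →* (AlgebraicClosure K)ˣ) := Finite.of_equiv _ e.symm.toEquiv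
  rw [← numCyclicSubgroups_congr (B := p.range →* (AlgebraicClosure K)ˣ) e, numCyclicSubgroups_eq_ncard,
    ← ncard_image_zpowers_image hinj]
  congr 2
  ext χ
  constructor
  · intro hχ
    have hχ' : p.rangeRestrict.ker ≤ χ.ker := by rwa [MonoidHom.ker_rangeRestrict]
    exact ⟨p.rangeRestrict.liftOfSurjective hs ⟨χ, hχ'⟩, trivial,
      p.rangeRestrict.liftOfRightInverse_comp _ (Function.rightInverse_surjInv hs) ⟨χ, hχ'⟩⟩
  · rintro ⟨ψ, -, rfl⟩ a ha
    have : p.rangeRestrict a = 1 := Subtype.ext ha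
    change ψ (p.rangeRestrict a) = 1
    rw [this, map_one]

/-- Every χ has χ(s) = ±1, and the sign depends only on the cyclic group generated by χ. The sign +
gives the characters of A/⟨s⟩, that is, of the range of p. -/
theorem ncard_image_zpowers_minus [NeZero (2 : K)] {k : ℕ} (hA : ∀ a : A, a ^ 2 ^ k = 1)
    (p : A →* B) {s : A} (hs : s * s = 1) (hp : ∀ a, a ∈ p.ker ↔ a = 1 ∨ a = s) :
    (Subgroup.zpowers '' {χ : A →* (AlgebraicClosure K)ˣ | (χ s : AlgebraicClosure K) = -1}).ncard +
      numCyclicSubgroups p.range =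
      numCyclicSubgroups A := by
  obtain ⟨e⟩ := monoidHom_mulEquiv_of_two_group (K := K) hA
  have : Finite (A →* (AlgebraicClosure K)ˣ) := Finite.of_equiv _ e.symm.toEquiv
  have h2 : (2 : AlgebraicClosure K) ≠ 0 := fun h =>
    NeZero.ne (2 : K) ((map_eq_zero (algebraMap K (AlgebraicClosure K))).1 (by rw [map_ofNat, h]))
  have hset : {χ : A →* (AlgebraicClosure K)ˣ | p.ker ≤ χ.ker} = {χ | (χ s : AlgebraicClosure K) = 1} := by
    ext χ
    constructor
    · intro h
      have : χ s = 1 := h ((hp s).2 (Or.inr rfl))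
      simp [this]
    · intro h a ha
      rcases (hp a).1 ha with rfl | rfl
      · exact one_mem _
      · exact Units.ext h
  rw [← ncard_image_zpowers_trivial_on_ker (K := K) hA p, hset, ← Set.ncard_image_union_of_ne,
    ← numCyclicSubgroups_congr (B := A →* (AlgebraicClosure K)ˣ) e, numCyclicSubgroups_eq_ncard]
  · congr 2
    ext χ
    refine ⟨fun _ => trivial, fun _ => ?_⟩
    have : (χ s : AlgebraicClosure K) ^ 2 = 1 ^ 2 := by
      rw [← Units.val_pow_eq_pow_val, ← map_pow, sq, hs]; simp
    exact (sq_eq_sq_iff_eq_or_eq_neg.1 this).symm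
  · intro χ hχ ψ hψ h
    have h1 : Subgroup.zpowers (χ s) = Subgroup.zpowers (ψ s) := by
      have := congrArg (Subgroup.map (MonoidHom.eval s)) h
      rwa [MonoidHom.map_zpowers, MonoidHom.map_zpowers] at this
    have h3 : ψ s = 1 := Units.ext hψ
    rw [h3, Subgroup.zpowers_one_eq_bot, Subgroup.zpowers_eq_bot] at h1
    have h4 : (χ s : AlgebraicClosure K) = -1 := hχ
    rw [h1, Units.val_one] at h4
    apply h2
    linear_combination h4

end

theorem exists_card_eq_two_pow {A : Type u} [Group A] [Finite A] {k : ℕ}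
    (hA : ∀ a : A, a ^ 2 ^ k = 1) : ∃ n, Nat.card A = 2 ^ n := by
  have : Fact (Nat.Prime 2) := ⟨Nat.prime_two⟩
  exact IsPGroup.iff_card.1 (fun a => ⟨k, hA a⟩)

theorem neZero_card {K : Type v} [Field K] [NeZero (2 : K)] {A : Type u} [Group A] [Finite A]
    {k : ℕ} (hA : ∀ a : A, a ^ 2 ^ k = 1) : NeZero (Nat.card A : K) := by
  obtain ⟨n, hn⟩ := exists_card_eq_two_pow hA
  exact ⟨by rw [hn, Nat.cast_pow, Nat.cast_ofNat]; exact pow_ne_zero _ (NeZero.ne 2)⟩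

theorem neZero_two_of_odd_card {K : Type v} [Field K] [Finite K] (hK : Odd (Nat.card K)) :
    NeZero (2 : K) := by
  refine ⟨fun h => ?_⟩
  have := Fintype.ofFinite K
  rw [Nat.card_eq_fintype_card] at hK
  have h2 : ringChar K = 2 :=
    CharP.ringChar_of_prime_eq_zero Nat.prime_two (by exact_mod_cast h)
  have := FiniteField.even_card_of_char_two h2
  have := Nat.odd_iff.1 hK
  omega

/-! ### Rational classes and cyclic subgroups of G/G' -/

namespace IsD4

variable {m₁ m₂ : ℕ} {G : Type u} [Group G] {x y : G} (h : IsD4 m₁ m₂ x y)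

include h

theorem sq_mem_center (g : G) : g ^ 2 ∈ Subgroup.center G := by
  have hmul : ∀ z t : G, z ∈ Subgroup.center G → t ^ 2 ∈ Subgroup.center G →
      (z * t) ^ 2 ∈ Subgroup.center G := by
    intro z t hz ht
    have : Commute z t := (Subgroup.mem_center_iff.1 hz t).symm
    rw [this.mul_pow]
    exact mul_mem (pow_mem hz 2) ht
  obtain ⟨z, hz, rfl | rfl | rfl | rfl⟩ := h.exists_center_mul g
  · exact pow_mem hz 2
  · exact hmul _ _ hz h.sq_x_mem_center
  · exact hmul _ _ hz h.sq_y_mem_center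
  · refine hmul _ _ hz ?_
    have : (x * y) ^ 2 = x ^ 2 * y ^ 2 * x ^ 2 ^ m₁ := by
      rw [sq, mul_assoc, ← mul_assoc y, h.mul_comm_eq, mul_assoc (x * y), (h.commute_pow y).eq, sq,
        sq]
      simp only [mul_assoc]
    rw [this]
    exact mul_mem (mul_mem h.sq_x_mem_center h.sq_y_mem_center) h.pow_mem_center

theorem pow_two_pow_eq_one (g : G) : g ^ 2 ^ (m₁ + m₂ + 1) = 1 := by
  obtain ⟨i, j, hij⟩ := (h.mem_center_iff _).1 (h.sq_mem_center g)
  have hc : Commute ((x ^ 2) ^ i) ((y ^ 2) ^ j) :=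
    ((h.commute_sq_x (y ^ 2)).pow_right j).pow_left i
  have hx : (x ^ 2) ^ 2 ^ (m₁ + m₂) = 1 := by
    rw [pow_add, pow_mul, ← pow_mul x, ← pow_succ', h.isD4Pair.pow_x, one_pow]
  have hy : (y ^ 2) ^ 2 ^ (m₁ + m₂) = 1 := by
    rw [add_comm m₁, pow_add, pow_mul, ← pow_mul y, ← pow_succ', h.isD4Pair.pow_y, one_pow]
  rw [pow_succ', pow_mul, hij, hc.mul_pow, pow_right_comm _ i, pow_right_comm _ j, hx, hy]
  simp

/-- The exponent of G is a power of 2 and at least 2, so the exponents coprime to it are the odd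
ones, and irreducibility realizes them all. -/
theorem exists_galois_pow_iff (K : Type v) [Field K] [CharZero K]
    (hK : ∀ n, 0 < n → Irreducible (Polynomial.cyclotomic n K)) (r : ℕ) :
    (∃ (σ : CyclotomicField (Monoid.exponent G) K ≃ₐ[K] CyclotomicField (Monoid.exponent G) K)
      (ζ : CyclotomicField (Monoid.exponent G) K),
      IsPrimitiveRoot ζ (Monoid.exponent G) ∧ σ ζ = ζ ^ r) ↔ Odd r := by
  have hdvd : Monoid.exponent G ∣ 2 ^ (m₁ + m₂ + 1) :=
    Monoid.exponent_dvd_of_forall_pow_eq_one h.pow_two_pow_eq_one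
  have h2 : 2 ∣ Monoid.exponent G := by
    have : orderOf (x ^ 2 ^ m₁) = 2 :=
      orderOf_eq_prime (by rw [sq, h.pow_two_pow_mul_self]) h.pow_ne_one
    exact this ▸ Monoid.order_dvd_exponent _
  have hpos : 0 < Monoid.exponent G := Nat.pos_of_dvd_of_pos hdvd (by positivity)
  have : NeZero (Monoid.exponent G) := ⟨hpos.ne'⟩
  constructor
  · rintro ⟨σ, ζ, hζ, hσ⟩
    have h1 : IsPrimitiveRoot (σ ζ) (Monoid.exponent G) := hζ.map_of_injective σ.injective
    rw [hσ, hζ.pow_iff_coprime hpos] at h1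
    exact Nat.coprime_two_right.1 (h1.coprime_dvd_right h2)
  · intro hr
    have hζ := IsCyclotomicExtension.zeta_spec (Monoid.exponent G) K
      (CyclotomicField (Monoid.exponent G) K)
    have hco : Nat.Coprime r (Monoid.exponent G) :=
      (hr.coprime_two_right.pow_right _).coprime_dvd_right hdvd
    exact ⟨_, _, hζ, IsCyclotomicExtension.fromZetaAut_spec (hζ.pow_of_coprime r hco)
      (hK _ hpos)⟩

theorem zpowers_of_eq_iff (g k : G) :
    Subgroup.zpowers (Abelianization.of g) = Subgroup.zpowers (Abelianization.of k) ↔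
      ∃ r, Odd r ∧ (k = g ^ r ∨ k = g ^ r * x ^ 2 ^ m₁) := by
  have hg : Abelianization.of g ^ 2 ^ (m₁ + m₂ + 1) = 1 := by
    rw [← map_pow, h.pow_two_pow_eq_one, map_one]
  rw [zpowers_eq_zpowers_iff_of_pow_two_pow hg]
  refine exists_congr fun r => and_congr_right fun _ => ?_
  rw [← map_pow, eq_comm, h.abelianization_of_eq_iff]

/-- Squares and s are central, so passing to another generator of the image does not leave the coset
of the centre. -/
theorem inv_mul_mem_center_of_zpowers_eq {g k : G}
    (hgk : Subgroup.zpowers (Abelianization.of g) = Subgroup.zpowers (Abelianization.of k)) :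
    g⁻¹ * k ∈ Subgroup.center G := by
  obtain ⟨r, hr, hk⟩ := (h.zpowers_of_eq_iff g k).1 hgk
  obtain ⟨c, rfl⟩ := hr
  have hc : g⁻¹ * g ^ (2 * c + 1) ∈ Subgroup.center G := by
    rw [pow_succ', inv_mul_cancel_left, pow_mul]
    exact pow_mem (h.sq_mem_center g) c
  rcases hk with rfl | rfl
  · exact hc
  · rw [← mul_assoc]
    exact mul_mem hc h.pow_mem_center

theorem isConj_iff_of_notMem_center {g k : G} (hg : g ∉ Subgroup.center G) :
    IsConj g k ↔ k = g ∨ k = g * x ^ 2 ^ m₁ := by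
  have hconj : ∀ c : G, c * g * c⁻¹ = g ∨ c * g * c⁻¹ = g * x ^ 2 ^ m₁ := by
    intro c
    rw [← h.abelianization_of_eq_iff]
    simp [mul_comm]
  rw [isConj_iff]
  constructor
  · rintro ⟨c, rfl⟩
    exact hconj c
  · rintro (rfl | rfl)
    · exact ⟨1, by simp⟩
    · rw [Subgroup.mem_center_iff] at hg
      push Not at hg
      obtain ⟨c, hc⟩ := hg
      refine ⟨c, (hconj c).resolve_left fun h' => hc ?_⟩
      rwa [mul_inv_eq_iff_eq_mul] at h'

/-- Conjugation of a noncentral element only adds the factor s, which generates G'; the Galois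
action supplies all odd powers. -/
theorem mem_kClass_iff {g k : G} (hg : g ∉ Subgroup.center G) :
    k ∈ kClass ℚ g ↔
      Subgroup.zpowers (Abelianization.of g) = Subgroup.zpowers (Abelianization.of k) := by
  have hpow : ∀ r, Odd r → g ^ r ∉ Subgroup.center G := by
    rintro r ⟨c, rfl⟩ hr
    rw [pow_succ, pow_mul, Subgroup.mul_mem_cancel_left _ (pow_mem (h.sq_mem_center g) c)] at hr
    exact hg hr
  rw [h.zpowers_of_eq_iff]
  constructor
  · rintro ⟨σ, ζ, r, hζ, hσ, hr⟩
    have hodd := (h.exists_galois_pow_iff ℚ (fun _ => Polynomial.cyclotomic.irreducible_rat) r).1 ⟨σ, ζ, hζ, hσ⟩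
    exact ⟨r, hodd, (h.isConj_iff_of_notMem_center (hpow r hodd)).1 hr⟩
  · rintro ⟨r, hodd, hk⟩
    obtain ⟨σ, ζ, hζ, hσ⟩ := (h.exists_galois_pow_iff ℚ (fun _ => Polynomial.cyclotomic.irreducible_rat) r).2 hodd
    exact ⟨σ, ζ, r, hζ, hσ, (h.isConj_iff_of_notMem_center (hpow r hodd)).2 hk⟩

theorem kClass_eq_iff {g k : G} (hg : g ∉ Subgroup.center G) (hk : k ∉ Subgroup.center G) :
    kClass ℚ g = kClass ℚ k ↔
      Subgroup.zpowers (Abelianization.of g) = Subgroup.zpowers (Abelianization.of k) := by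
  constructor
  · intro hgk
    rw [← h.mem_kClass_iff hg, hgk, h.mem_kClass_iff hk]
  · intro hgk
    ext l
    rw [h.mem_kClass_iff hg, h.mem_kClass_iff hk, hgk]

theorem numKClassesInvolving_eq {t : G} (ht : t ∉ Subgroup.center G) :
    numKClassesInvolving ℚ t =
      ((fun g : G => Subgroup.zpowers (Abelianization.of g)) ''
        {g | ∃ z ∈ Subgroup.center G, g = z * t}).ncard := by
  have := h.finite
  have hset : {S : Set G | ∃ a ∈ Subgroup.center G, S = kClass ℚ (a * t)} =
      kClass ℚ '' {g | ∃ z ∈ Subgroup.center G, g = z * t} := by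
    ext S
    constructor
    · rintro ⟨a, ha, rfl⟩
      exact ⟨_, ⟨a, ha, rfl⟩, rfl⟩
    · rintro ⟨_, ⟨a, ha, rfl⟩, rfl⟩
      exact ⟨a, ha, rfl⟩
  rw [numKClassesInvolving, hset]
  have hnot : ∀ g ∈ {g | ∃ z ∈ Subgroup.center G, g = z * t}, g ∉ Subgroup.center G := by
    rintro _ ⟨z, hz, rfl⟩
    rwa [Subgroup.mul_mem_cancel_left _ hz]
  exact Set.ncard_image_eq_of_iff fun g hg k hk => h.kClass_eq_iff (hnot g hg) (hnot k hk)

theorem x_notMem_center : x ∉ Subgroup.center G := fun hx =>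
  h.not_commute (Subgroup.mem_center_iff.1 hx y).symm

theorem y_notMem_center : y ∉ Subgroup.center G := fun hy =>
  h.not_commute (Subgroup.mem_center_iff.1 hy x)

theorem xy_notMem_center : x * y ∉ Subgroup.center G := fun hxy => by
  have := Subgroup.mem_center_iff.1 hxy x
  rw [mul_assoc] at this
  exact h.not_commute (mul_left_cancel this)

omit h in
/-- The projection of the centre to the abelianization. -/
def centerToAb (G : Type u) [Group G] : Subgroup.center G →* Abelianization G :=
  Abelianization.of.comp (Subgroup.center G).subtype

theorem mem_ker_centerToAb_iff (a : Subgroup.center G) :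
    a ∈ (centerToAb G).ker ↔ a = 1 ∨ a = h.centralInvolution := by
  have : a ∈ (centerToAb G).ker ↔ Abelianization.of (1 : G) = Abelianization.of (a : G) := by
    rw [MonoidHom.mem_ker, map_one, eq_comm]; rfl
  rw [this, h.abelianization_of_eq_iff, one_mul]
  exact or_congr (by rw [← Subgroup.coe_one, Subtype.coe_inj]) (by rw [Subtype.ext_iff]; rfl)

/-- G is the union of the cosets of 1, x, y, xy modulo the centre, and elements of different cosets
generate different cyclic subgroups of G/G'. -/
theorem numCyclicSubgroups_abelianization :
    numCyclicSubgroups (Abelianization G) = numCyclicSubgroups (centerToAb G).range +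
      numKClassesInvolving ℚ x + numKClassesInvolving ℚ y + numKClassesInvolving ℚ (x * y) := by
  have := h.finite
  have : Finite (Abelianization G) := Quotient.finite _
  set f : G → Subgroup (Abelianization G) := fun g => Subgroup.zpowers (Abelianization.of g)
  set T : G → Set G := fun t => {g | ∃ z ∈ Subgroup.center G, g = z * t} with hT
  have hne : ∀ t t' : G, t⁻¹ * t' ∉ Subgroup.center G → ∀ a ∈ T t, ∀ b ∈ T t', f a ≠ f b := by
    rintro t t' htt _ ⟨z, hz, rfl⟩ _ ⟨z', hz', rfl⟩ hab
    have := h.inv_mul_mem_center_of_zpowers_eq hab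
    rw [mul_inv_rev, mul_assoc, ← mul_assoc z⁻¹, ← mul_assoc,
      Subgroup.mem_center_iff.1 (mul_mem (inv_mem hz) hz') t⁻¹, mul_assoc,
      Subgroup.mul_mem_cancel_left _ (mul_mem (inv_mem hz) hz')] at this
    exact htt this
  have huniv : (Set.univ : Set G) = ((T 1 ∪ T x) ∪ T y) ∪ T (x * y) := by
    ext g
    obtain ⟨z, hz, hg⟩ := h.exists_center_mul g
    simp only [Set.mem_univ, true_iff]
    rcases hg with hg | hg | hg | hg
    · exact Or.inl (Or.inl (Or.inl ⟨z, hz, by rw [hg, mul_one]⟩))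
    · exact Or.inl (Or.inl (Or.inr ⟨z, hz, hg⟩))
    · exact Or.inl (Or.inr ⟨z, hz, hg⟩)
    · exact Or.inr ⟨z, hz, hg⟩
  have hall : numCyclicSubgroups (Abelianization G) = (f '' Set.univ).ncard := by
    rw [numCyclicSubgroups_eq_ncard, ← Set.image_univ_of_surjective
      (Abelianization.of_surjective G), Set.image_image]
  have h1 : numCyclicSubgroups (centerToAb G).range = (f '' T 1).ncard := by
    rw [numCyclicSubgroups_eq_ncard,
      ← ncard_image_zpowers_image (f := (centerToAb G).range.subtype) Subtype.val_injective]
    rw [show f = Subgroup.zpowers ∘ Abelianization.of from rfl, Set.image_comp]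
    congr 2
    ext g
    constructor
    · rintro ⟨⟨_, ⟨z, rfl⟩⟩, -, rfl⟩
      exact ⟨z, ⟨z, z.2, (mul_one _).symm⟩, rfl⟩
    · rintro ⟨_, ⟨z, hz, rfl⟩, rfl⟩
      exact ⟨⟨_, ⟨⟨z, hz⟩, rfl⟩⟩, trivial, by rw [mul_one]; rfl⟩
  have hxy : x⁻¹ * y ∉ Subgroup.center G := fun hc => by
    have := Subgroup.mem_center_iff.1 hc x
    rw [mul_inv_cancel_left, mul_assoc, eq_inv_mul_iff_mul_eq] at this
    exact h.not_commute this
  have hyxy : y⁻¹ * (x * y) ∉ Subgroup.center G := fun hc => by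
    have := Subgroup.mem_center_iff.1 hc y
    rw [mul_inv_cancel_left, mul_assoc, eq_inv_mul_iff_mul_eq, ← mul_assoc] at this
    exact h.not_commute (mul_right_cancel this).symm
  rw [h.numKClassesInvolving_eq h.x_notMem_center, h.numKClassesInvolving_eq h.y_notMem_center,
    h.numKClassesInvolving_eq h.xy_notMem_center, hall, h1, huniv,
    Set.ncard_image_union_of_ne, Set.ncard_image_union_of_ne, Set.ncard_image_union_of_ne]
  · exact hne _ _ (by simpa using h.x_notMem_center)
  · rintro a (ha | ha)
    · exact hne _ _ (by simpa using h.y_notMem_center) a ha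
    · exact hne _ _ hxy a ha
  · rintro a ((ha | ha) | ha)
    · exact hne _ _ (by simpa using h.xy_notMem_center) a ha
    · exact hne _ _ (by simpa using h.y_notMem_center) a ha
    · exact hne _ _ hyxy a ha

end IsD4

/-! ### The numbers of fields and of quaternion algebras -/

namespace IsD4

variable {m₁ m₂ : ℕ} {G : Type u} [Group G] {x y : G} (h : IsD4 m₁ m₂ x y)

include h

theorem center_pow (a : Subgroup.center G) : a ^ 2 ^ (m₁ + m₂ + 1) = 1 :=
  Subtype.ext (h.pow_two_pow_eq_one a)

theorem abelianization_pow (a : Abelianization G) : a ^ 2 ^ (m₁ + m₂ + 1) = 1 := by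
  obtain ⟨g, rfl⟩ := Abelianization.of_surjective G a
  rw [← map_pow, h.pow_two_pow_eq_one, map_one]

theorem ncard_image_zpowers_centralInvolution (K : Type v) [Field K] [NeZero (2 : K)] :
    (Subgroup.zpowers '' {χ : Subgroup.center G →* (AlgebraicClosure K)ˣ |
      (χ h.centralInvolution : AlgebraicClosure K) = -1}).ncard +
        numCyclicSubgroups (centerToAb G).range = numCyclicSubgroups (Subgroup.center G) := by
  have := h.finite
  exact ncard_image_zpowers_minus h.center_pow (centerToAb G) (Subtype.ext h.pow_two_pow_mul_self)
    h.mem_ker_centerToAb_iff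

theorem card_minusSpectrum_rat :
    Nat.card (h.MinusSpectrum ℚ) + numCyclicSubgroups (centerToAb G).range =
      numCyclicSubgroups (Subgroup.center G) := by
  have := h.finite
  rw [← h.ncard_image_zpowers_centralInvolution ℚ, card_maximalSpectrum_rat h.center_pow]
  simp only [single_add_one_mem_charIdeal_iff]

theorem card_minusSpectrum_finite (hm₁ : 3 ≤ m₁) (K : Type v) [Field K] [Finite K]
    (hK : Odd (Nat.card K)) :
    2 * Nat.card (h.MinusSpectrum ℚ) ≤ Nat.card (h.MinusSpectrum K) ∧
    (Nat.card K % 8 = 3 → Nat.card (h.MinusSpectrum K) = 2 * Nat.card (h.MinusSpectrum ℚ)) := by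
  have := h.finite
  have := neZero_two_of_odd_card hK
  have h1 := h.card_minusSpectrum_rat
  have h2 := h.ncard_image_zpowers_centralInvolution K
  rw [card_maximalSpectrum_finite hK h.center_pow]
  simp only [single_add_one_mem_charIdeal_iff]
  set S := {χ : Subgroup.center G →* (AlgebraicClosure K)ˣ |
      (χ h.centralInvolution : AlgebraicClosure K) = -1} with hS
  -- Over ℚ and over K the cyclic groups of minus characters are counted by the same difference,
  -- which depends only on G.
  have hcard : Nat.card (h.MinusSpectrum ℚ) = (Subgroup.zpowers '' S).ncard := by omega
  rw [hcard]
  obtain ⟨e⟩ := monoidHom_mulEquiv_of_two_group (K := K) h.center_pow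
  have : Finite (Subgroup.center G →* (AlgebraicClosure K)ˣ) := Finite.of_equiv _ e.symm.toEquiv
  refine two_mul_ncard_image_zpowers (k := m₁ + m₂ + 1) hK
    (fun χ => MonoidHom.ext fun a => ?_) S (fun χ hχ h4 => ?_) fun χ hχ r hr => ?_
  · rw [MonoidHom.pow_apply, ← map_pow, h.center_pow, map_one, MonoidHom.one_apply]
  · obtain ⟨n, rfl⟩ := Nat.exists_eq_add_of_le' hm₁
    -- As m₁ ≥ 3, s is a fourth power in the centre, so χ^4 = 1 would give χ(s) = 1.
    have hs : h.centralInvolution = (⟨x ^ 2, h.sq_x_mem_center⟩ ^ 2 ^ n) ^ 4 := by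
      ext
      change x ^ 2 ^ (n + 3) = ((x ^ 2) ^ 2 ^ n) ^ 4
      rw [← pow_mul, ← pow_mul]
      congr 1
      ring
    have h5 : χ h.centralInvolution = 1 := by
      rw [hs, map_pow, ← MonoidHom.pow_apply, h4, MonoidHom.one_apply]
    have h6 : (χ h.centralInvolution : AlgebraicClosure K) = -1 := hχ
    rw [h5, Units.val_one] at h6
    exact NeZero.ne (2 : K) ((map_eq_zero (algebraMap K (AlgebraicClosure K))).1
      (by rw [map_ofNat]; linear_combination h6))
  · have h6 : (χ h.centralInvolution : AlgebraicClosure K) = -1 := hχ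
    change (((χ ^ r) h.centralInvolution : (AlgebraicClosure K)ˣ) : AlgebraicClosure K) = -1
    rw [MonoidHom.pow_apply, Units.val_pow_eq_pow_val, h6, hr.neg_one_pow]

theorem card_maximalSpectrum_abelianization_rat :
    Nat.card (MaximalSpectrum (MonoidAlgebra ℚ (Abelianization G))) =
      numCyclicSubgroups (Abelianization G) := by
  have := h.finite
  have : Finite (Abelianization G) := Quotient.finite _
  obtain ⟨e⟩ := monoidHom_mulEquiv_of_two_group (K := ℚ) h.abelianization_pow
  have : Finite (Abelianization G →* (AlgebraicClosure ℚ)ˣ) := Finite.of_equiv _ e.symm.toEquiv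
  have h1 := card_maximalSpectrum_rat h.abelianization_pow fun _ => True
  rw [← numCyclicSubgroups_congr (B := Abelianization G →* (AlgebraicClosure ℚ)ˣ) e,
    numCyclicSubgroups_eq_ncard, ← Nat.card_congr (Equiv.subtypeUnivEquiv fun _ => trivial), h1]
  rfl

theorem card_maximalSpectrum_abelianization_finite (hm₁ : 3 ≤ m₁) (hm₂ : 3 ≤ m₂)
    (K : Type v) [Field K] [Finite K] (hK : Odd (Nat.card K)) :
    2 * numCyclicSubgroups (Abelianization G) - 10 ≤
      Nat.card (MaximalSpectrum (MonoidAlgebra K (Abelianization G))) ∧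
    (Nat.card K % 8 = 3 → Nat.card (MaximalSpectrum (MonoidAlgebra K (Abelianization G))) =
      2 * numCyclicSubgroups (Abelianization G) - 10) := by
  have := h.finite
  have : Finite (Abelianization G) := Quotient.finite _
  have := neZero_two_of_odd_card hK
  obtain ⟨e⟩ := monoidHom_mulEquiv_of_two_group (K := K) h.abelianization_pow
  obtain ⟨e'⟩ := h.abelianization_mulEquiv
  have : Finite (Abelianization G →* (AlgebraicClosure K)ˣ) := Finite.of_equiv _ e.symm.toEquiv
  have h1 := card_maximalSpectrum_finite hK h.abelianization_pow fun _ => True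
  rw [← numCyclicSubgroups_congr (B := Abelianization G →* (AlgebraicClosure K)ˣ) e,
    ← Nat.card_congr (Equiv.subtypeUnivEquiv fun _ => trivial), h1]
  exact (card_powOrbit_of_ncard_eq_ten (k := m₁ + m₂ + 1) hK
    (fun χ => MonoidHom.ext fun a => by
      rw [MonoidHom.pow_apply, ← map_pow, h.abelianization_pow, map_one, MonoidHom.one_apply])
    (ncard_image_zpowers_pow_four (B := Abelianization G →* (AlgebraicClosure K)ˣ)
      (by omega) (by omega) (e.trans e'))).2

theorem ten_le_numCyclicSubgroups (hm₁ : 3 ≤ m₁) (hm₂ : 3 ≤ m₂) :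
    10 ≤ numCyclicSubgroups (Abelianization G) := by
  have := h.finite
  have : Finite (Abelianization G) := Quotient.finite _
  obtain ⟨e⟩ := h.abelianization_mulEquiv
  -- The bound does not involve q, so q = 1 serves.
  exact (card_powOrbit_of_ncard_eq_ten odd_one h.abelianization_pow
    (ncard_image_zpowers_pow_four (by omega) (by omega) e)).1

end IsD4

theorem mainTheorem4 (m₁ m₂ : ℕ) (hm₁ : 3 ≤ m₁) (hm₂ : 3 ≤ m₂)
    (G : Type u) [Group G] (φ : D4Group m₁ m₂ ≃* G)
    (x y : G) (hx : x = φ (PresentedGroup.of D4Gen.x)) (hy : y = φ (PresentedGroup.of D4Gen.y))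
    (N₁ N₂ N₃ N₄ N N₀ : ℕ)
    (hN₁ : N₁ = numCyclicSubgroups (Subgroup.center G))
    (hN₂ : N₂ = numKClassesInvolving ℚ x)
    (hN₃ : N₃ = numKClassesInvolving ℚ y)
    (hN₄ : N₄ = numKClassesInvolving ℚ (x * y))
    (hN : N = N₁ + N₂ + N₃ + N₄)
    (hN₀ : N₀ = numCyclicSubgroups (G ⧸ commutator G)) :
    -- the subtractions of natural numbers below are genuine
    (5 ≤ N₀ ∧ N₀ ≤ N) ∧
    IsSumOfFieldsAndQuaternions ℚ (MonoidAlgebra ℚ G) N₀ (N - N₀) ∧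
    ∀ (K : Type v) [Field K] [Finite K], Odd (Nat.card K) →
      (IsSemisimpleRing (MonoidAlgebra K G) ∧
        2 * N - 10 ≤ numSimpleComponents (MonoidAlgebra K G)) ∧
      (Nat.card K ≡ 3 [MOD 8] →
        numSimpleComponents (MonoidAlgebra K G) = 2 * N - 10 ∧
        IsSumOfFieldsAndQuaternions K (MonoidAlgebra K G) (2 * N₀ - 10) (2 * (N - N₀))) := by
  have h : IsD4 m₁ m₂ x y := ⟨by omega, φ, hx.symm, hy.symm⟩
  have hfin := h.finite
  have : Finite (Abelianization G) := Quotient.finite _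
  replace hN₀ : N₀ = numCyclicSubgroups (Abelianization G) := hN₀
  have hten := h.ten_le_numCyclicSubgroups hm₁ hm₂
  have hminus := h.card_minusSpectrum_rat
  have hab := h.numCyclicSubgroups_abelianization
  -- N₂, N₃ and N₄ cancel, leaving N₁ minus the number of cyclic subgroups of the image of the
  -- centre.
  have hsub : N - N₀ = Nat.card (h.MinusSpectrum ℚ) := by omega
  refine ⟨⟨by omega, by omega⟩, ?_, fun K _ _ hK => ?_⟩
  · have := neZero_card (K := ℚ) h.center_pow
    have := neZero_card (K := ℚ) h.abelianization_pow
    have hsum := h.isSumOfFieldsAndQuaternions ℚ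
    rwa [h.card_maximalSpectrum_abelianization_rat, ← hN₀, ← hsub] at hsum
  · have := neZero_two_of_odd_card hK
    have := neZero_card (K := K) h.center_pow
    have := neZero_card (K := K) h.abelianization_pow
    have := neZero_card (K := K) h.pow_two_pow_eq_one
    have hsum := h.isSumOfFieldsAndQuaternions K
    have hcount := hsum.numSimpleComponents_eq
    obtain ⟨hF, hF'⟩ := h.card_maximalSpectrum_abelianization_finite hm₁ hm₂ K hK
    obtain ⟨hQ, hQ'⟩ := h.card_minusSpectrum_finite hm₁ K hK
    -- Maschke's theorem gives semisimplicity; the bounds add up as (2N₀ - 10) + 2(N - N₀) = 2N -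
    -- 10.
    refine ⟨⟨inferInstance, by omega⟩, fun h3 => ?_⟩
    have h3' : Nat.card K % 8 = 3 := h3
    rw [hF' h3', hQ' h3', ← hN₀, ← hsub] at hsum
    exact ⟨by have := hF' h3'; have := hQ' h3'; omega, hsum⟩
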